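/- Let $\mathbf k$ be a commutative unitary ring containing $\mathbb Q$, let $X=\{x_i\mid i\in\mathbb P\}$ be commuting variables indexed by the positive integers $\mathbb P$, and let $t,z$ be further variables. A weak composition is a finite (possibly empty) list $\alpha=(\alpha_1,\dots,\alpha_k)$ of nonnegative integers; it is left weak if it is empty or $\alpha_k>0$. For a left weak composition $\alpha$ put $$M_\alpha=\sum_{0<i_1<\cdots<i_k}x_{i_1}^{\alpha_1}\cdots x_{i_k}^{\alpha_k}\in\mathbf k[[X]],$$ and let $\mathrm{LWQSym}\subseteq\mathbf k[[X]]$ be the $\mathbf k$-span of these series (the left weak quasisymmetric functions). For a weak composition $\alpha=(\alpha_1,\dots,\alpha_k)$ and $\beta=(\beta_1,\dots,\beta_k)\in\mathbb P^k$ let $\phi\binom{\alpha}{\beta}\in\mathbb Q[[X]][t][z^{-1},z]]$ be the element given, coefficientwise in $X$, by the Laurent expansion at $z=0$ of $$\sum_{0<i_1<\cdots<i_k}x_{i_1}^{\alpha_1}\cdots x_{i_k}^{\alpha_k}\,e^{(i_1+t)\beta_1z}\cdots e^{(i_k+t)\beta_kz}\qquad(t\ge 0,\ \operatorname{Re}z<0).$$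 Let $P$ be the projection of a Laurent series in $z$ onto its polar part $\sum_{n<0}a_nz^n$. Define $\phi_-(\emptyset)=\phi_+(\emptyset)=1$ and, for $k\ge1$, $$\phi_-\tbinom{\alpha}{\beta}=-P(\bar\phi),\qquad \phi_+\tbinom{\alpha}{\beta}=(\mathrm{id}-P)(\bar\phi),\qquad \bar\phi=\phi\tbinom{\alpha}{\beta}+\sum_{i=1}^{k-1}\phi\tbinom{\alpha_1,\dots,\alpha_i}{\beta_1,\dots,\beta_i}\,\phi_-\tbinom{\alpha_{i+1},\dots,\alpha_k}{\beta_{i+1},\dots,\beta_k}.$$ Fix any $\delta\in\mathbb P$. The renormalized monomial quasisymmetric function of a weak composition $\alpha$ of length $k$ is $M_\alpha:=\phi_+\binom{\alpha}{\delta,\dots,\delta}\big|_{z=0}$, regarded as an element of $\mathbf k[[X]][t]$, and $\mathrm{RenQSym}\subseteq\mathbf k[[X]][t]$ is the $\mathbf k$-span of all $M_\alpha$, $\alpha$ a weak composition. **Theorem.** For every $\delta\in\mathbb P$, $\mathrm{LWQSym}$ is a $\mathbf k$-subalgebra of $\mathbf k[[X]]$, $\mathrm{RenQSym}$ is a $\mathbf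 k$-subalgebra of $\mathbf k[[X]][t]$, and $$\mathrm{RenQSym}=\mathrm{LWQSym}[t],$$ the algebra of polynomials in $t$ with coefficients in $\mathrm{LWQSym}$. Moreover, the renormalized monomial quasisymmetric function of the weak composition $(0)$ is $M_{(0)}=-t-\tfrac12$. -/

import Mathlib

open scoped Topology

noncomputable section

namespace RenormalizedQSym

/-- Words in `ℕ × ℙ`: the basis of the quasi-shuffle Hopf algebra `QS(ℕ × ℙ)`. The word
`[(α₁, β₁), …, (α_k, β_k)]` is the weak composition `α` taken in the direction `β`. -/
abbrev DirectedWord : Type := List (ℕ × ℕ+)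

/-- The exponent of `x_{i₁}^{α₁} ⋯ x_{i_k}^{α_k}` in the variables `x₁, x₂, …`. -/
def monomialExponent {n : ℕ} (α : Fin n → ℕ) (i : Fin n → ℕ+) : ℕ+ →₀ ℕ :=
  ∑ j, Finsupp.single (i j) (α j)

/-- Strictly increasing sequences `i₁ < ⋯ < i_k` of positive integers with
`x_{i₁}^{α₁} ⋯ x_{i_k}^{α_k} = x^m`. -/
abbrev IndexSeq {n : ℕ} (α : Fin n → ℕ) (m : ℕ+ →₀ ℕ) : Type :=
  {i : Fin n ↪o ℕ+ // monomialExponent α i = m}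

/-- A weak composition is left weak if its last component, if there is one, is positive.
(The empty composition is left weak.) -/
def IsLeftWeak (α : List ℕ) : Prop := ∀ a ∈ α.getLast?, 0 < a

/-- The monomial power series `M_α = ∑_{i₁ < ⋯ < i_k} x_{i₁}^{α₁} ⋯ x_{i_k}^{α_k}` of a left weak
composition `α`: the coefficient of `x^m` is the number of terms equal to `x^m`, which is finite
when `α` is left weak. -/
def leftWeakMonomial (k : Type*) [CommRing k] (α : List ℕ) : MvPowerSeries ℕ+ k :=
  fun m => (Nat.card (IndexSeq α.get m) : k)

/-- Left weak quasisymmetric functions: the linear combinations of the `M_α`, `α` left weak. -/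
def LWQSym (k : Type*) [CommRing k] : Submodule k (MvPowerSeries ℕ+ k) :=
  Submodule.span k {f | ∃ α : List ℕ, IsLeftWeak α ∧ f = leftWeakMonomial k α}

/-- The coefficient of `x^m` in the regularized sum
`∑_{i₁ < ⋯ < i_k} x_{i₁}^{α₁} ⋯ x_{i_k}^{α_k} e^{(i₁+t) β₁ z} ⋯ e^{(i_k+t) β_k z}`;
the series converges absolutely for `t ≥ 0` and `Re z < 0`. -/
def regularizedCoeff (w : DirectedWord) (m : ℕ+ →₀ ℕ) (t : ℝ) (z : ℂ) : ℂ :=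
  ∑' i : IndexSeq (fun j => (w.get j).1) m,
    ∏ j, Complex.exp ((((i.1 j : ℕ) : ℂ) + (t : ℂ)) * (((w.get j).2 : ℕ) : ℂ) * z)

/-- The ring `ℚ[[X]][t][z⁻¹, z]]`, with `X = {x_i | i ∈ ℙ}`. -/
abbrev Target : Type := LaurentSeries (Polynomial (MvPowerSeries ℕ+ ℚ))

/-- `F` is the expansion of the regularized sum of `w`: for every monomial `x^m` and every `t ≥ 0`,
the coefficient of `x^m` in `F` is a Laurent series in `z` which converges to the coefficient of
`x^m` in the regularized sum, for all `z` near `0` with `Re z < 0`. At most one `F` has this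
property. -/
def IsRegularization (w : DirectedWord) (F : Target) : Prop :=
  ∀ (m : ℕ+ →₀ ℕ) (t : ℝ), 0 ≤ t →
    ∀ᶠ z : ℂ in 𝓝[{z : ℂ | z.re < 0}] 0,
      HasSum
        (fun n : ℤ =>
          (F.coeff n).sum (fun s f => ((MvPowerSeries.coeff m f : ℚ) : ℂ) * (t : ℂ) ^ s) * z ^ n)
        (regularizedCoeff w m t z)

open Classical in
/-- The regularization map `φ`, on words. (The default value is never taken.) -/
def regularization (w : DirectedWord) : Target :=
  if h : ∃ F, IsRegularization w F then h.choose else 0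

/-- The projection `P` of a Laurent series in `z` onto its polar part. -/
def polarPart (F : Target) : Target := HahnSeries.truncLT (0 : ℤ) F

/-- The factor `φ₋` of the algebraic Birkhoff factorization `φ = φ₊ ⋆ φ₋^{⋆(-1)}`, on words:
`φ₋(∅) = 1` and `φ₋(w) = -P(φ(w) + ∑ φ(w') φ₋(w''))`, where the sum is over the deconcatenations
`w = w' w''` with `w'` and `w''` nonempty. -/
def birkhoffMinus : DirectedWord → Target
  | [] => 1
  | a :: l =>
      -polarPart (regularization (a :: l) +
        ∑ i : Fin l.length, regularization (a :: l.take i) * birkhoffMinus (l.drop i))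
termination_by w => w.length
decreasing_by simp

/-- The factor `φ₊`, the renormalization of `φ`, on words:
`φ₊(∅) = 1` and `φ₊(w) = (id - P)(φ(w) + ∑ φ(w') φ₋(w''))`, with the same sum as for `φ₋`. -/
def birkhoffPlus : DirectedWord → Target
  | [] => 1
  | a :: l =>
      let F := regularization (a :: l) +
        ∑ i : Fin l.length, regularization (a :: l.take i) * birkhoffMinus (l.drop i)
      F - polarPart F

/-- The directional quasisymmetric function `Z(w) = φ₊(w)|_{z = 0}`. -/
def directional (w : DirectedWord) : Polynomial (MvPowerSeries ℕ+ ℚ) := (birkhoffPlus w).coeff 0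

/-- The renormalized monomial quasisymmetric function `M_α` of a weak composition `α`, which is
`Z` of `α` in the constant direction `(δ, …, δ)`, as an element of `k[[X]][t]`. -/
def renMonomial (k : Type*) [CommRing k] [Algebra ℚ k] (δ : ℕ+) (α : List ℕ) :
    Polynomial (MvPowerSeries ℕ+ k) :=
  (directional (α.map fun a => (a, δ))).map (MvPowerSeries.map (algebraMap ℚ k))

/-- Renormalized quasisymmetric functions: the linear combinations of the `M_α`, `α` a weak
composition. -/
def RenQSym (k : Type*) [CommRing k] [Algebra ℚ k] (δ : ℕ+) :
    Submodule k (Polynomial (MvPowerSeries ℕ+ k)) :=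
  Submodule.span k (Set.range (renMonomial k δ))

end RenormalizedQSym

end

/-! Fix the direction `(δ, …, δ)` and put `q = e^{δz}`. Only words of zeros make the regularized sum
singular. Peeling off letters until the monomial `x^m` is used up leaves a sum for some word `0^r`
over indices above some `n`, and this sum is the elementary symmetric function `e_r(q^{n+1},
q^{n+2}, …)` (up to a factor `e^{tδz}` per letter). Its generating function in `y` is that for `n =
0` divided by the finite product `∏_{i ≤ n} (1 + q^i y)`. Hence (`eq_invSum_mul`,
`iterCoeff_eq_conv`) `φ` is a deconcatenation convolution `Q ⋆ Z`: `Q` is a polynomial expression in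
exponentials, so regular at `z = 0`, and `Z` is supported on the words `0^r`.

By `birkhoff_eq_conv` it then suffices to factorize `Z`, and this takes place in commutative power
series in `y`. By Newton's identities (`derivative_geometric`) the logarithmic derivative of `∑
Z(0^r) y^r` has as coefficients signed power sums, each with a simple pole in `z`. Exponentiating
minus the polar parts gives `φ₋`, and exponentiating the regular parts gives `φ₊` on the words `0^r`
(`sum_zerosLaurent_mul_zerosMinus`). At `z = 0` each regular part is `-t - 1/2` up to the
alternating sign, whatever `δ` is, so `φ₊(0^r)` becomes the binomial coefficient of `-t - 1/2` over
`r`.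

Let `ρ` be `Q` at `z = 0` (`regularValue`). It equals `M_u` on a left weak word `u`, vanishes on
`0^r` for `r ≥ 1`, and is multiplicative for the quasi-shuffle product (`regularValue_mul`); its
span is therefore an algebra, and it is `LWQSym`. Finally `M_{u0^r} = ∑ ρ(u0^i) binom(-t - 1/2, r -
i)` is triangular in `r`, and these binomial coefficients span the same space as the powers of `t`,
whence `RenQSym = LWQSym[t]`.

The passage from the analytic definition of `φ` to formal series is `isRegularization_conv`,
together with the identity theorem behind `IsRegularization.unique`. -/

namespace RenormalizedQSym

/-! ### Deconcatenation convolution and forms supported on words of zeros. -/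

section Convolution

variable {R : Type*} [CommRing R]

/-- The convolution of two linear forms on words with respect to deconcatenation. -/
def conv : (List ℕ → R) → (List ℕ → R) → List ℕ → R
  | f, g, [] => f [] * g []
  | f, g, a :: w => f [] * g (a :: w) + conv (fun v => f (a :: v)) g w

/-- The linear form on words that vanishes on words with a nonzero letter and whose value on
the word `0ʳ` is `x r`. -/
def onZeros (x : ℕ → R) (w : List ℕ) : R := if ∀ a ∈ w, a = 0 then x w.length else 0

lemma onZeros_nil (x : ℕ → R) : onZeros x [] = x 0 := by simp [onZeros]

lemma onZeros_cons_zero (x : ℕ → R) (w : List ℕ) :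
    onZeros x (0 :: w) = onZeros (fun r => x (r + 1)) w := by
  simp [onZeros]

lemma onZeros_cons_of_ne (x : ℕ → R) {a : ℕ} (ha : a ≠ 0) (w : List ℕ) :
    onZeros x (a :: w) = 0 := by
  simp [onZeros, ha]

lemma onZeros_replicate (x : ℕ → R) (r : ℕ) : onZeros x (List.replicate r 0) = x r := by
  simp [onZeros]

lemma conv_add_left (f f' g : List ℕ → R) (w : List ℕ) :
    conv (fun v => f v + f' v) g w = conv f g w + conv f' g w := by
  induction w generalizing f f' with
  | nil => simp only [conv]; ring
  | cons a w ih => simp only [conv, ih]; ring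

lemma conv_mul_left (c : R) (f g : List ℕ → R) (w : List ℕ) :
    conv (fun v => c * f v) g w = c * conv f g w := by
  induction w generalizing f with
  | nil => simp only [conv]; ring
  | cons a w ih => simp only [conv, ih]; ring

lemma conv_zero_left (g : List ℕ → R) (w : List ℕ) : conv (fun _ => 0) g w = 0 := by
  induction w with
  | nil => simp [conv]
  | cons a w ih => simp [conv, ih]

lemma conv_sum_left {ι : Type*} (s : Finset ι) (f : ι → List ℕ → R) (g : List ℕ → R)
    (w : List ℕ) :
    conv (fun v => ∑ i ∈ s, f i v) g w = ∑ i ∈ s, conv (f i) g w := by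
  classical
  induction s using Finset.induction_on with
  | empty => simp [conv_zero_left]
  | insert i s hi ih => simp only [Finset.sum_insert hi, conv_add_left, ih]

lemma conv_assoc (f g h : List ℕ → R) (w : List ℕ) :
    conv (conv f g) h w = conv f (conv g h) w := by
  induction w generalizing f with
  | nil => simp only [conv]; ring
  | cons a w ih =>
    simp only [conv, conv_add_left, conv_mul_left, ih]
    ring

lemma conv_congr {f f' g g' : List ℕ → R} (hf : ∀ v, f v = f' v) (hg : ∀ v, g v = g' v)
    (w : List ℕ) : conv f g w = conv f' g' w := by
  rw [funext hf, funext hg]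

lemma map_conv {R' : Type*} [CommRing R'] (φ : R →+* R') (f g : List ℕ → R) (w : List ℕ) :
    φ (conv f g w) = conv (fun v => φ (f v)) (fun v => φ (g v)) w := by
  induction w generalizing f with
  | nil => simp [conv]
  | cons a w ih => simp [conv, ih]

/-- Deconcatenation preserves total length. This is what allows powers of `z` to be moved in and
out, turning Laurent series into power series. -/
lemma conv_pow_length (c : R) (f g : List ℕ → R) (w : List ℕ) :
    conv (fun v => c ^ v.length * f v) (fun v => c ^ v.length * g v) w =
      c ^ w.length * conv f g w := by
  induction w generalizing f with
  | nil => simp [conv]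
  | cons a w ih =>
    simp only [conv, List.length_cons, List.length_nil, pow_succ', mul_assoc, conv_mul_left, ih,
      pow_zero]
    ring

lemma conv_onZeros (s x : ℕ → R) (w : List ℕ) :
    conv (onZeros s) (onZeros x) w =
      onZeros (fun r => ∑ p ∈ Finset.HasAntidiagonal.antidiagonal r, s p.1 * x p.2) w := by
  induction w generalizing s with
  | nil => simp [conv, onZeros_nil]
  | cons a w ih =>
    by_cases ha : a = 0
    · subst ha
      simp only [conv, onZeros_cons_zero, ih, onZeros_nil, Finset.Nat.sum_antidiagonal_succ]
      unfold onZeros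
      split_ifs <;> simp
    · simp [conv, onZeros_cons_of_ne _ ha, conv_zero_left]

lemma conv_eq_sum_range (f g : List ℕ → R) (w : List ℕ) :
    conv f g w = ∑ i ∈ Finset.range (w.length + 1), f (w.take i) * g (w.drop i) := by
  induction w generalizing f with
  | nil => simp [conv]
  | cons a w ih =>
    rw [conv, ih, List.length_cons, Finset.sum_range_succ' _ (w.length + 1)]
    simp [add_comm]

/-- A left weak word followed by zeros is only cut among the zeros. -/
lemma conv_onZeros_append_replicate (f : List ℕ → R) (x : ℕ → R) {u : List ℕ}
    (hu : IsLeftWeak u) (r : ℕ) :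
    conv f (onZeros x) (u ++ List.replicate r 0) =
      ∑ p ∈ Finset.HasAntidiagonal.antidiagonal r, f (u ++ List.replicate p.1 0) * x p.2 := by
  induction u generalizing f with
  | nil =>
    simp only [List.nil_append]
    induction r generalizing f with
    | zero => simp [conv, onZeros_nil]
    | succ r ih =>
      rw [List.replicate_succ, conv, ih, ← List.replicate_succ, onZeros_replicate,
        Finset.Nat.sum_antidiagonal_succ]
      simp [List.replicate_succ]
  | cons a u ih =>
    have h0 : onZeros x (a :: (u ++ List.replicate r 0)) = 0 := by
      have hlast : (a :: u).getLast (by simp) ≠ 0 :=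
        (hu _ (List.getLast_mem_getLast? (by simp))).ne'
      rw [onZeros, if_neg]
      intro h
      exact hlast (h _ (by
        rw [← List.cons_append]
        exact List.mem_append_left _ (List.getLast_mem _)))
    have hu' : IsLeftWeak u := by
      rcases u with _ | ⟨b, u⟩
      · intro c hc; simp at hc
      · intro c hc; exact hu c (by simpa [List.getLast?_cons_cons] using hc)
    rw [List.cons_append, conv, h0, mul_zero, zero_add, ih _ hu']
    simp

end Convolution

/-! ### Coefficients of nested sums, with prescribed values on words of zeros. -/

section IteratedCoefficient

/-- The largest index of a variable occurring in `x^m`. -/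
def maxIndex (m : ℕ+ →₀ ℕ) : ℕ := m.support.sup fun i => (i : ℕ)

lemma le_maxIndex {m : ℕ+ →₀ ℕ} {i : ℕ+} (h : m i ≠ 0) : (i : ℕ) ≤ maxIndex m :=
  Finset.le_sup (f := fun i : ℕ+ => (i : ℕ)) (Finsupp.mem_support_iff.mpr h)

lemma eq_zero_of_maxIndex_lt {m : ℕ+ →₀ ℕ} {i : ℕ+} (h : maxIndex m < i) : m i = 0 := by
  by_contra h'
  exact absurd (le_maxIndex h') (not_le.mpr h)

lemma maxIndex_mono {m m' : ℕ+ →₀ ℕ} (h : m ≤ m') : maxIndex m ≤ maxIndex m' :=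
  Finset.sup_le fun i hi => le_maxIndex (by
    have := h i
    have := Finsupp.mem_support_iff.mp hi
    omega)

variable {R : Type*} [CommRing R]

/-- The coefficient of `x^m` in `∑ ε_{i₁} x_{i₁}^{a₁} ⋯ ε_{i_k} x_{i_k}^{a_k}` over
`n < i₁ < ⋯ < i_k` (the weight of `x_{i+1}` being `ε i`), where `S n r` stands for the value of
the sum for the word `0ʳ`. -/
noncomputable def iterCoeff (ε : ℕ → R) (S : ℕ → ℕ → R) : ℕ → List ℕ → (ℕ+ →₀ ℕ) → R
  | _, [], m => if m = 0 then 1 else 0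
  | n, a :: w, m =>
    if m = 0 then onZeros (S n) (a :: w)
    else ∑ i ∈ Finset.Ico n (maxIndex m),
      if Finsupp.single i.succPNat a ≤ m then
        ε i * iterCoeff ε S (i + 1) w (m - Finsupp.single i.succPNat a)
      else 0

variable {ε : ℕ → R} {S : ℕ → ℕ → R}

lemma iterCoeff_zero (hS : ∀ n, S n 0 = 1) (n : ℕ) (w : List ℕ) :
    iterCoeff ε S n w 0 = onZeros (S n) w := by
  cases w with
  | nil => simp [iterCoeff, onZeros_nil, hS]
  | cons a w => simp [iterCoeff]

lemma iterCoeff_cons_of_ne {m : ℕ+ →₀ ℕ} (hm : m ≠ 0) (n a : ℕ) (w : List ℕ) :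
    iterCoeff ε S n (a :: w) m = ∑ i ∈ Finset.Ico n (maxIndex m),
      if Finsupp.single i.succPNat a ≤ m then
        ε i * iterCoeff ε S (i + 1) w (m - Finsupp.single i.succPNat a)
      else 0 := by
  rw [iterCoeff, if_neg hm]

lemma iterCoeff_eq_zero {m : ℕ+ →₀ ℕ} (hm : m ≠ 0) {n : ℕ} (h : maxIndex m ≤ n) (w : List ℕ) :
    iterCoeff ε S n w m = 0 := by
  cases w with
  | nil => simp [iterCoeff, hm]
  | cons a w => rw [iterCoeff_cons_of_ne hm, Finset.Ico_eq_empty (by omega), Finset.sum_empty]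

lemma single_succPNat_le_iff {m : ℕ+ →₀ ℕ} {n a : ℕ} (h : maxIndex m ≤ n) :
    Finsupp.single n.succPNat a ≤ m ↔ a = 0 := by
  have : m n.succPNat = 0 := eq_zero_of_maxIndex_lt (by simpa using Nat.lt_succ_of_le h)
  rw [Finsupp.single_le_iff, this]
  omega

/-- Either the first index exceeds `n + 1` or it equals `n + 1`. For `m = 0` this dichotomy has to
be imposed on the prescribed values, which is `hrec`. -/
lemma iterCoeff_cons_eq (hS : ∀ n, S n 0 = 1)
    (hrec : ∀ n r, S n (r + 1) = S (n + 1) (r + 1) + ε n * S (n + 1) r)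
    (n a : ℕ) (w : List ℕ) (m : ℕ+ →₀ ℕ) :
    iterCoeff ε S n (a :: w) m = iterCoeff ε S (n + 1) (a :: w) m +
      if Finsupp.single n.succPNat a ≤ m then
        ε n * iterCoeff ε S (n + 1) w (m - Finsupp.single n.succPNat a)
      else 0 := by
  by_cases hm : m = 0
  · subst hm
    rw [iterCoeff_zero hS, iterCoeff_zero hS]
    by_cases ha : a = 0
    · subst ha
      rw [onZeros_cons_zero, onZeros_cons_zero]
      rw [if_pos (by simp), Finsupp.single_zero, tsub_zero, iterCoeff_zero hS, funext (hrec n)]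
      unfold onZeros
      split_ifs <;> simp
    · simp [onZeros_cons_of_ne _ ha, ha]
  · rcases lt_or_ge n (maxIndex m) with h | h
    · rw [iterCoeff_cons_of_ne hm, iterCoeff_cons_of_ne hm, Finset.sum_eq_sum_Ico_succ_bot h]
      ring
    · rw [iterCoeff_eq_zero hm h, iterCoeff_eq_zero hm (by omega)]
      split_ifs with h'
      · rw [single_succPNat_le_iff h] at h'
        subst h'
        simp [iterCoeff_eq_zero hm (show maxIndex m ≤ n + 1 by omega)]
      · simp

/-- The prescribed values enter only when the monomial is exhausted and zeros remain. A factor `x`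
independent of `n` can therefore be split off the end of the word. -/
lemma iterCoeff_eq_conv {χ : ℕ → ℕ → R} {x : ℕ → R} (hS : ∀ n, S n 0 = 1) (hx : x 0 = 1)
    (hχ : ∀ n r, χ n r = ∑ p ∈ Finset.HasAntidiagonal.antidiagonal r, S n p.1 * x p.2)
    (n : ℕ) (w : List ℕ) (m : ℕ+ →₀ ℕ) :
    iterCoeff ε χ n w m = conv (fun v => iterCoeff ε S n v m) (onZeros x) w := by
  induction w generalizing n m with
  | nil => simp [iterCoeff, conv, onZeros_nil, hx]
  | cons a w ih =>
    by_cases hm : m = 0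
    · subst hm
      rw [iterCoeff_zero (fun n => by simp [hχ, hS, hx]), conv_congr (iterCoeff_zero hS n)
        (fun _ => rfl), conv_onZeros, funext (hχ n)]
    · have h0 : iterCoeff ε S n [] m = 0 := by simp [iterCoeff, hm]
      simp only [conv, iterCoeff_cons_of_ne hm, conv_sum_left, h0, zero_mul, zero_add]
      refine Finset.sum_congr rfl fun i _ => ?_
      split_ifs
      · rw [ih, conv_mul_left]
      · rw [conv_zero_left]

/-- The values on the words `0ʳ` of the convolution inverses of the truncated sums over
`0 < i₁ < ⋯ < i_r ≤ n`. -/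
def invSum (ε : ℕ → R) : ℕ → ℕ → R
  | _, 0 => 1
  | 0, _ + 1 => 0
  | n + 1, r + 1 => invSum ε n (r + 1) - ε n * invSum ε (n + 1) r

lemma invSum_zero_right (n : ℕ) : invSum ε n 0 = 1 := by cases n <;> simp [invSum]

lemma invSum_succ (n r : ℕ) :
    invSum ε n (r + 1) = invSum ε (n + 1) (r + 1) + ε n * invSum ε (n + 1) r := by
  rw [invSum]; ring

/-- In generating functions, `hrec` reads `χ_n = (1 + ε_n y) χ_{n+1}`, so `χ_n` is `χ_0` divided by
`∏_{i<n} (1 + ε_i y)`. No convergence is involved, and all dependence on `n` lies in a finite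
product. -/
lemma eq_invSum_mul {χ : ℕ → ℕ → R} (hχ : ∀ n, χ n 0 = 1)
    (hrec : ∀ n r, χ n (r + 1) = χ (n + 1) (r + 1) + ε n * χ (n + 1) r) (n r : ℕ) :
    χ n r = ∑ p ∈ Finset.HasAntidiagonal.antidiagonal r, invSum ε n p.1 * χ 0 p.2 := by
  induction n generalizing r with
  | zero =>
    cases r with
    | zero => simp [hχ, invSum]
    | succ r =>
      simp [Finset.Nat.sum_antidiagonal_succ, invSum]
  | succ n ihn =>
    induction r with
    | zero => simp [hχ, invSum]
    | succ r ihr =>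
      have h1 := ihn (r + 1)
      rw [Finset.Nat.sum_antidiagonal_succ] at h1 ⊢
      have h2 : χ (n + 1) (r + 1) = χ n (r + 1) - ε n * χ (n + 1) r := by rw [hrec n r]; ring
      rw [h2, h1, ihr, Finset.mul_sum, invSum_zero_right, invSum_zero_right, add_sub_assoc,
        ← Finset.sum_sub_distrib]
      congr 1
      refine Finset.sum_congr rfl fun p _ => ?_
      simp only [invSum]
      ring

lemma map_iterCoeff {R' : Type*} [CommRing R'] (φ : R →+* R') (n : ℕ) (w : List ℕ)
    (m : ℕ+ →₀ ℕ) :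
    φ (iterCoeff ε S n w m) =
      iterCoeff (fun i => φ (ε i)) (fun n r => φ (S n r)) n w m := by
  induction w generalizing n m with
  | nil => simp [iterCoeff, apply_ite φ]
  | cons a w ih => simp [iterCoeff, apply_ite φ, ih, onZeros]

lemma map_invSum {R' : Type*} [CommRing R'] (φ : R →+* R') (n r : ℕ) :
    φ (invSum ε n r) = invSum (fun i => φ (ε i)) n r := by
  induction n generalizing r with
  | zero => cases r <;> simp [invSum]
  | succ n ih =>
    induction r with
    | zero => simp [invSum]
    | succ r ihr => simp [invSum, ih, ihr]

end IteratedCoefficient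

/-! ### Nested sums as sums over increasing index sequences. -/

section IndexSequences

/-- Strictly increasing sequences `n₀ < i₁ < ⋯ < i_n` with `x_{i₁}^{v₁} ⋯ x_{i_n}^{v_n} = x^m`. -/
abbrev IndexSeqAbove (n₀ : ℕ) {n : ℕ} (v : Fin n → ℕ) (m : ℕ+ →₀ ℕ) : Type :=
  {i : Fin n ↪o ℕ+ // (∀ j, n₀ < (i j : ℕ)) ∧ monomialExponent v i = m}

/-- The possible tails of the sequences in `IndexSeqAbove` with first index `i + 1`. -/
abbrev IndexSeqTail (n₀ a : ℕ) {n : ℕ} (v : Fin n → ℕ) (m : ℕ+ →₀ ℕ) (i : ℕ) : Type :=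
  {x : Fin n ↪o ℕ+ // n₀ ≤ i ∧ (∀ j, i + 1 < (x j : ℕ)) ∧
    Finsupp.single i.succPNat a + monomialExponent v x = m}

lemma monomialExponent_succ {n : ℕ} (v : Fin (n + 1) → ℕ) (i : Fin (n + 1) → ℕ+) :
    monomialExponent v i =
      Finsupp.single (i 0) (v 0) + monomialExponent (fun j => v j.succ) (fun j => i j.succ) := by
  simp [monomialExponent, Fin.sum_univ_succ]

/-- Sequences with no lower bound on the first index. -/
def indexSeqEquiv {n : ℕ} (v : Fin n → ℕ) (m : ℕ+ →₀ ℕ) :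
    IndexSeq v m ≃ IndexSeqAbove 0 v m :=
  Equiv.subtypeEquivRight fun i => by simp

/-- Splitting off the first index. -/
def indexSeqConsEquiv (n₀ : ℕ) {n : ℕ} (v : Fin (n + 1) → ℕ) (m : ℕ+ →₀ ℕ) :
    IndexSeqAbove n₀ v m ≃ Σ i : ℕ, IndexSeqTail n₀ (v 0) (fun j => v j.succ) m i where
  toFun s := ⟨(s.1 0).natPred,
    OrderEmbedding.ofStrictMono (fun j : Fin n => s.1 j.succ)
      (fun _ _ h => s.1.strictMono (Fin.succ_lt_succ_iff.mpr h)),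
    by
      have := s.2.1 0
      rw [← PNat.natPred_add_one] at this
      omega,
    fun j => by
      rw [PNat.natPred_add_one]
      exact s.1.strictMono (Fin.succ_pos j),
    by
      rw [PNat.succPNat_natPred]
      exact (monomialExponent_succ v s.1).symm.trans s.2.2⟩
  invFun p := ⟨OrderEmbedding.ofStrictMono (Fin.cons p.1.succPNat p.2.1 : Fin (n + 1) → ℕ+)
      (by
        refine Fin.strictMono_cons.mpr ⟨fun j => ?_, p.2.1.strictMono⟩
        exact PNat.coe_lt_coe _ _ |>.mp (by simpa using p.2.2.2.1 j)),
    by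
      intro j
      refine Fin.cases ?_ (fun k => ?_) j
      · have := p.2.2.1
        simp
        omega
      · have := p.2.2.1
        have := p.2.2.2.1 k
        simp
        omega,
    by
      have := p.2.2.2.2
      rw [monomialExponent_succ]
      simpa using this⟩
  left_inv s := by
    ext j
    refine Fin.cases ?_ (fun k => ?_) j
    · simp
    · simp
      rfl
  right_inv p := by
    rcases p with ⟨i, x, h⟩
    simp
    rfl

/-- A tail is a sequence for the remaining exponent. -/
def indexSeqTailEquiv {n₀ a : ℕ} {n : ℕ} (v : Fin n → ℕ) {m : ℕ+ →₀ ℕ} {i : ℕ} (hi : n₀ ≤ i)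
    (hm : Finsupp.single i.succPNat a ≤ m) :
    IndexSeqTail n₀ a v m i ≃ IndexSeqAbove (i + 1) v (m - Finsupp.single i.succPNat a) :=
  Equiv.subtypeEquivRight fun x => by
    rw [eq_tsub_iff_add_eq_of_le hm, add_comm (monomialExponent v x)]
    simp [hi]

lemma isEmpty_indexSeqTail {n₀ a : ℕ} {n : ℕ} (v : Fin n → ℕ) {m : ℕ+ →₀ ℕ} {i : ℕ}
    (h : ¬(n₀ ≤ i ∧ Finsupp.single i.succPNat a ≤ m)) : IsEmpty (IndexSeqTail n₀ a v m i) :=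
  ⟨fun x => h ⟨x.2.1, le_of_le_of_eq le_self_add x.2.2.2⟩⟩

/-- `iterCoeff` is the sum over the corresponding sequences, if the values given for the words
`0ʳ` are the corresponding sums. -/
theorem hasSum_iterCoeff {τ : Type*} (f : τ → ℕ) (P : List ℕ → Prop)
    (hP : ∀ a w, P (a :: w) → P w) {ε : ℕ → ℂ} {χ : ℕ → ℕ → ℂ} (hχ : ∀ n, χ n 0 = 1)
    (hz : ∀ r n, P (List.replicate (r + 1) 0) →
      HasSum (fun i => if n ≤ i then ε i * χ (i + 1) r else 0) (χ n (r + 1)))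
    (hS : ∀ (W : List τ) n m, P (W.map f) → Summable
      (fun s : IndexSeqAbove n (fun j => f (W.get j)) m => ∏ j, ε (s.1 j).natPred))
    (W : List τ) (n : ℕ) (m : ℕ+ →₀ ℕ) (hW : P (W.map f)) :
    HasSum (fun s : IndexSeqAbove n (fun j => f (W.get j)) m => ∏ j, ε (s.1 j).natPred)
      (iterCoeff ε χ n (W.map f) m) := by
  induction W generalizing n m with
  | nil =>
    have huniq : ∀ s t : Fin 0 ↪o ℕ+, s = t := fun s t => by ext j; exact j.elim0
    by_cases hm : m = 0
    · subst hm
      have : Unique (IndexSeqAbove n (fun j => f (([] : List τ).get j)) 0) :=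
        { default := ⟨OrderEmbedding.ofStrictMono (fun j : Fin 0 => j.elim0)
            (fun j => j.elim0), fun j => j.elim0, by simp [monomialExponent]⟩
          uniq := fun s => Subtype.ext (huniq _ _) }
      simp [iterCoeff]
    · have : IsEmpty (IndexSeqAbove n (fun j => f (([] : List τ).get j)) m) :=
        ⟨fun s => hm (by simpa [monomialExponent] using s.2.2.symm)⟩
      rw [List.map_nil, iterCoeff, if_neg hm]
      exact hasSum_empty
  | cons p W ih =>
    have hW' : P (W.map f) := hP _ _ hW
    let e : IndexSeqAbove n (fun j => f ((p :: W).get j)) m ≃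
        Σ i : ℕ, IndexSeqTail n (f p) (fun j => f (W.get j)) m i :=
      indexSeqConsEquiv n (fun j => f ((p :: W).get j)) m
    -- The sum is grouped by its first index; summability of the whole family, supplied by `hS`,
    -- justifies the regrouping.
    refine (Equiv.hasSum_iff e.symm).mp (HasSum.sigma_of_hasSum (g := fun i =>
      if n ≤ i ∧ Finsupp.single i.succPNat (f p) ≤ m then
        ε i * iterCoeff ε χ (i + 1) (W.map f) (m - Finsupp.single i.succPNat (f p)) else 0)
      ?_ (fun i => ?_) (e.symm.summable_iff.mpr (hS (p :: W) n m hW)))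
    · rw [List.map_cons]
      by_cases hm : m = 0
      · subst hm
        rw [iterCoeff_zero hχ]
        by_cases ha : f p = 0
        · by_cases hw : ∀ a ∈ W.map f, a = 0
          · have h1 : W.map f = List.replicate W.length 0 :=
              List.eq_replicate_iff.mpr ⟨by simp, hw⟩
            have := hz W.length n (by
              rw [List.replicate_succ, ← h1, ← ha]; exact hW)
            rw [ha, onZeros_cons_zero, h1, onZeros_replicate]
            simpa [iterCoeff_zero hχ, onZeros_replicate] using this
          · rw [ha, onZeros_cons_zero, onZeros, if_neg hw]
            convert hasSum_zero using 2
            rw [Finsupp.single_zero, tsub_zero, iterCoeff_zero hχ, onZeros, if_neg hw]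
            simp
        · rw [onZeros_cons_of_ne _ ha]
          convert hasSum_zero using 2
          simp [ha]
      · rw [iterCoeff_cons_of_ne hm]
        have : ∀ i ∈ Finset.Ico n (maxIndex m),
            (if Finsupp.single i.succPNat (f p) ≤ m then
              ε i * iterCoeff ε χ (i + 1) (W.map f) (m - Finsupp.single i.succPNat (f p)) else 0) =
            if n ≤ i ∧ Finsupp.single i.succPNat (f p) ≤ m then
              ε i * iterCoeff ε χ (i + 1) (W.map f) (m - Finsupp.single i.succPNat (f p))
              else 0 := fun i hi => by simp [(Finset.mem_Ico.mp hi).1]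
        rw [Finset.sum_congr rfl this]
        refine hasSum_sum_of_ne_finset_zero fun i hi => ?_
        rw [ite_eq_right_iff]
        rintro ⟨h1, h2⟩
        -- A first index beyond all variables of `x^m` must carry exponent `0`, and the later
        -- indices can no longer produce `x^m`, so the term vanishes.
        have h3 : maxIndex m ≤ i := by
          by_contra h
          exact hi (Finset.mem_Ico.mpr ⟨h1, not_le.mp h⟩)
        rw [single_succPNat_le_iff h3] at h2
        rw [h2, Finsupp.single_zero, tsub_zero, iterCoeff_eq_zero hm (by omega), mul_zero]
    · by_cases h : n ≤ i ∧ Finsupp.single i.succPNat (f p) ≤ m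
      · rw [if_pos h, ← (indexSeqTailEquiv (fun j => f (W.get j)) h.1 h.2).symm.hasSum_iff]
        have hs := (ih (i + 1) (m - Finsupp.single i.succPNat (f p)) hW').mul_left (ε i)
        refine (congrArg (fun F => HasSum F _ _) (funext fun s => ?_)).mpr hs
        exact (Fin.prod_univ_succ _).trans (by congr 1)
      · have := isEmpty_indexSeqTail (fun j => f (W.get j)) h
        rw [if_neg h]
        exact hasSum_empty

end IndexSequences

/-! ### The quasi-shuffle product and trailing zeros. -/

section QuasiShuffle

/-- The words in the quasi-shuffle product of two words, with multiplicities. -/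
def quasiShuffle : List ℕ → List ℕ → Multiset (List ℕ)
  | [], w => {w}
  | a :: v, [] => {a :: v}
  | a :: v, b :: w =>
    (quasiShuffle v (b :: w)).map (List.cons a) + (quasiShuffle (a :: v) w).map (List.cons b) +
      (quasiShuffle v w).map (List.cons (a + b))
termination_by v w => v.length + w.length

lemma quasiShuffle_nil_left (w : List ℕ) : quasiShuffle [] w = {w} := by
  simp [quasiShuffle]

lemma quasiShuffle_nil_right (w : List ℕ) : quasiShuffle w [] = {w} := by
  cases w <;> simp [quasiShuffle]

lemma quasiShuffle_cons_cons (a b : ℕ) (v w : List ℕ) :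
    quasiShuffle (a :: v) (b :: w) =
      (quasiShuffle v (b :: w)).map (List.cons a) + (quasiShuffle (a :: v) w).map (List.cons b) +
      (quasiShuffle v w).map (List.cons (a + b)) := by
  rw [quasiShuffle]

lemma IsLeftWeak.nil : IsLeftWeak [] := fun a ha => by simp at ha

lemma IsLeftWeak.cons {w : List ℕ} (hw : IsLeftWeak w) (h : w ≠ []) (a : ℕ) :
    IsLeftWeak (a :: w) := by
  obtain ⟨b, v, rfl⟩ := List.exists_cons_of_ne_nil h
  intro c hc
  exact hw c (by simpa [List.getLast?_cons_cons] using hc)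

lemma IsLeftWeak.of_cons {a : ℕ} {w : List ℕ} (h : IsLeftWeak (a :: w)) : IsLeftWeak w := by
  rcases w with _ | ⟨b, w⟩
  · exact IsLeftWeak.nil
  · intro c hc
    exact h c (by simpa [List.getLast?_cons_cons] using hc)

lemma isLeftWeak_singleton {a : ℕ} : IsLeftWeak [a] ↔ 0 < a := by
  simp [IsLeftWeak]

lemma exists_eq_append_replicate (w : List ℕ) :
    ∃ u r, IsLeftWeak u ∧ w = u ++ List.replicate r 0 := by
  induction w with
  | nil => exact ⟨[], 0, IsLeftWeak.nil, rfl⟩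
  | cons a w ih =>
    obtain ⟨u, r, hu, rfl⟩ := ih
    by_cases h : u = []
    · subst h
      rcases Nat.eq_zero_or_pos a with rfl | ha
      · exact ⟨[], r + 1, IsLeftWeak.nil, by simp [List.replicate_succ]⟩
      · exact ⟨[a], r, isLeftWeak_singleton.mpr ha, by simp⟩
    · exact ⟨a :: u, r, hu.cons h a, rfl⟩

/-- Words with a nonzero letter and fewer than `r` trailing zeros. -/
def FewerZeros (r : ℕ) (w : List ℕ) : Prop :=
  ∃ u s, u ≠ [] ∧ IsLeftWeak u ∧ s < r ∧ w = u ++ List.replicate s 0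

lemma FewerZeros.cons {r : ℕ} {w : List ℕ} (h : FewerZeros r w) (a : ℕ) :
    FewerZeros r (a :: w) := by
  obtain ⟨u, s, h1, h2, h3, rfl⟩ := h
  exact ⟨a :: u, s, by simp, h2.cons h1 a, h3, rfl⟩

lemma FewerZeros.succ {r : ℕ} {w : List ℕ} (h : FewerZeros r w) : FewerZeros (r + 1) w := by
  obtain ⟨u, s, h1, h2, h3, rfl⟩ := h
  exact ⟨u, s, h1, h2, by omega, rfl⟩

lemma fewerZeros_append {u : List ℕ} (hu : u ≠ []) (hw : IsLeftWeak u) (r : ℕ) :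
    FewerZeros (r + 1) (u ++ List.replicate r 0) := ⟨u, r, hu, hw, by omega, rfl⟩

/-- The last letter of `u` is nonzero, so trailing zeros of a product word come from `0^r`. All `r`
of them trail only if every zero is placed after `u` without merging, which happens exactly once. -/
lemma quasiShuffle_replicate {u : List ℕ} (hu : u ≠ []) (hw : IsLeftWeak u) (r : ℕ) :
    ∃ Γ : Multiset (List ℕ), quasiShuffle u (List.replicate r 0) =
      {u ++ List.replicate r 0} + Γ ∧ ∀ w ∈ Γ, FewerZeros r w := by
  induction u generalizing r with
  | nil => exact absurd rfl hu
  | cons a u ihu =>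
    induction r with
    | zero => exact ⟨0, by simp [quasiShuffle_nil_right], by simp⟩
    | succ r ihr =>
      obtain ⟨Γ₂, h2, h2'⟩ := ihr
      rw [List.replicate_succ, quasiShuffle_cons_cons, h2, ← List.replicate_succ]
      by_cases h : u = []
      · subst h
        refine ⟨{0 :: ([a] ++ List.replicate r 0)} + Γ₂.map (List.cons 0) +
          {a :: List.replicate r 0}, ?_, fun w hmem => ?_⟩
        · simp only [quasiShuffle_nil_left, Multiset.map_singleton, Multiset.map_add, add_zero,
            List.singleton_append, add_assoc]
        · simp only [Multiset.mem_add, Multiset.mem_singleton, Multiset.mem_map] at hmem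
          rcases hmem with (rfl | ⟨v, hv, rfl⟩) | rfl
          · exact (fewerZeros_append (by simp) hw r).cons 0
          · exact ((h2' v hv).cons 0).succ
          · exact fewerZeros_append (u := [a]) (by simp) hw r
      · obtain ⟨Γ₁, h1, h1'⟩ := ihu h hw.of_cons (r + 1)
        obtain ⟨Γ₃, h3, h3'⟩ := ihu h hw.of_cons r
        refine ⟨Γ₁.map (List.cons a) + ({0 :: (a :: u ++ List.replicate r 0)} +
          Γ₂.map (List.cons 0)) + ({a :: (u ++ List.replicate r 0)} + Γ₃.map (List.cons a)),
          ?_, fun w hmem => ?_⟩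
        · rw [h1, h3]
          simp only [Multiset.map_singleton, Multiset.map_add, add_zero, List.cons_append,
            add_assoc]
        · simp only [Multiset.mem_add, Multiset.mem_singleton, Multiset.mem_map] at hmem
          rcases hmem with (⟨v, hv, rfl⟩ | (rfl | ⟨v, hv, rfl⟩)) | (rfl | ⟨v, hv, rfl⟩)
          · exact (h1' v hv).cons a
          · exact (fewerZeros_append (by simp) hw r).cons 0
          · exact ((h2' v hv).cons 0).succ
          · exact (fewerZeros_append h hw.of_cons r).cons a
          · exact ((h3' v hv).cons a).succ

end QuasiShuffle

/-! ### The character at `z = 0` and the algebra of left weak quasisymmetric functions. -/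

section Characters

variable (R : Type*) [CommRing R]

/-- The values at `z = 0` of the regular part of the regularized sums over `n < i₁ < ⋯ < i_k`. -/
noncomputable def regularValue (n : ℕ) (w : List ℕ) : MvPowerSeries ℕ+ R :=
  fun m => iterCoeff (fun _ => 1) (invSum fun _ => 1) n w m

variable {R}

lemma coeff_regularValue (n : ℕ) (w : List ℕ) (m : ℕ+ →₀ ℕ) :
    MvPowerSeries.coeff m (regularValue R n w) =
      iterCoeff (fun _ => 1) (invSum fun _ => 1) n w m := rfl

/-- These coefficients are universal integers, so identities can be checked in one ring and
transported to another. -/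
lemma map_iterCoeff_one {R' : Type*} [CommRing R'] (φ : R →+* R') (n : ℕ) (w : List ℕ)
    (m : ℕ+ →₀ ℕ) :
    φ (iterCoeff (fun _ => 1) (invSum fun _ => 1) n w m) =
      iterCoeff (fun _ => 1) (invSum fun _ => 1) n w m := by
  rw [map_iterCoeff]
  simp [map_invSum]

lemma map_regularValue {R' : Type*} [CommRing R'] (φ : R →+* R') (n : ℕ) (w : List ℕ) :
    MvPowerSeries.map φ (regularValue R n w) = regularValue R' n w := by
  ext m
  rw [MvPowerSeries.coeff_map, coeff_regularValue, coeff_regularValue, map_iterCoeff_one]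

lemma regularValue_nil (n : ℕ) : regularValue R n [] = 1 := by
  classical
  ext m
  rw [coeff_regularValue, iterCoeff, MvPowerSeries.coeff_one]

lemma regularValue_cons (n a : ℕ) (w : List ℕ) :
    regularValue R n (a :: w) = regularValue R (n + 1) (a :: w) +
      MvPowerSeries.monomial (Finsupp.single n.succPNat a) 1 * regularValue R (n + 1) w := by
  classical
  ext m
  rw [map_add, MvPowerSeries.coeff_monomial_mul, coeff_regularValue,
    iterCoeff_cons_eq invSum_zero_right (fun n r => invSum_succ n r)]
  rfl

lemma onZeros_invSum_zero (w : List ℕ) :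
    onZeros (invSum (fun _ => (1 : R)) 0) w = if w = [] then 1 else 0 := by
  cases w with
  | nil => simp [onZeros_nil, invSum]
  | cons a w => simp [onZeros, invSum]

lemma onZeros_invSum_succ (n a : ℕ) (w : List ℕ) :
    onZeros (invSum (fun _ => (1 : R)) n) (a :: w) =
      onZeros (invSum (fun _ => (1 : R)) (n + 1)) (a :: w) +
        (if a = 0 then 1 else 0) * onZeros (invSum (fun _ => (1 : R)) (n + 1)) w := by
  by_cases ha : a = 0
  · subst ha
    rw [onZeros_cons_zero, onZeros_cons_zero, funext (invSum_succ (ε := fun _ => (1 : R)) n)]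
    simp only [if_true, one_mul]
    unfold onZeros
    split_ifs <;> simp
  · simp [onZeros_cons_of_ne _ ha, ha]

/-- Induction upwards from `n = 0`, where the form is the counit. The recurrence expresses values at
`n` through values at `n + 1`; with the shorter products at `n + 1` known, the multiplicativity at
`n` can be solved for that at `n + 1`. -/
lemma onZeros_mul (n : ℕ) (v w : List ℕ) :
    onZeros (invSum (fun _ => (1 : R)) n) v * onZeros (invSum (fun _ => (1 : R)) n) w =
      ((quasiShuffle v w).map (onZeros (invSum (fun _ => (1 : R)) n))).sum := by
  induction n generalizing v w with
  | zero =>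
    rcases v with _ | ⟨a, v⟩
    · simp [quasiShuffle_nil_left, onZeros_nil, invSum]
    rcases w with _ | ⟨b, w⟩
    · simp [quasiShuffle_nil_right, onZeros_nil, invSum]
    · simp [quasiShuffle_cons_cons, onZeros_invSum_zero]
  | succ n ih =>
    induction hl : v.length + w.length using Nat.strong_induction_on generalizing v w with
    | _ l ihl =>
      rcases v with _ | ⟨a, v⟩
      · simp [quasiShuffle_nil_left, onZeros_nil, invSum]
      rcases w with _ | ⟨b, w⟩
      · simp [quasiShuffle_nil_right, onZeros_nil, invSum]
      have h1 := ihl _ (by simp at hl ⊢; omega) v (b :: w) rfl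
      have h2 := ihl _ (by simp at hl ⊢; omega) (a :: v) w rfl
      have h3 := ihl _ (by simp at hl ⊢; omega) v w rfl
      have h0 := ih (a :: v) (b :: w)
      have hab : (if a + b = 0 then (1 : R) else 0) =
          (if a = 0 then 1 else 0) * (if b = 0 then 1 else 0) := by
        by_cases ha : a = 0 <;> by_cases hb : b = 0 <;> simp [ha, hb]
      rw [quasiShuffle_cons_cons] at h0 ⊢
      simp only [Multiset.map_add, Multiset.sum_add, Multiset.map_map, Function.comp_def,
        onZeros_invSum_succ n, Multiset.sum_map_add, Multiset.sum_map_mul_left, ← h1, ← h2,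
        ← h3, hab] at h0 ⊢
      linear_combination h0

/-- Equality of the coefficients of all monomials in `x₁, …, x_N`. -/
def EqUpTo (N : ℕ) (F G : MvPowerSeries ℕ+ R) : Prop :=
  ∀ m, maxIndex m ≤ N → MvPowerSeries.coeff m F = MvPowerSeries.coeff m G

lemma EqUpTo.add {N : ℕ} {F F' G G' : MvPowerSeries ℕ+ R} (h : EqUpTo N F G)
    (h' : EqUpTo N F' G') : EqUpTo N (F + F') (G + G') := fun m hm => by
  rw [map_add, map_add, h m hm, h' m hm]

lemma EqUpTo.mul_left {N : ℕ} {F G : MvPowerSeries ℕ+ R} (h : EqUpTo N F G)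
    (H : MvPowerSeries ℕ+ R) : EqUpTo N (H * F) (H * G) := fun m hm => by
  classical
  rw [MvPowerSeries.coeff_mul, MvPowerSeries.coeff_mul]
  refine Finset.sum_congr rfl fun p hp => ?_
  rw [h p.2 ((maxIndex_mono (le_of_le_of_eq le_add_self
    (Finset.HasAntidiagonal.mem_antidiagonal.mp hp))).trans hm)]

/-- Induction downwards on `n`, with `d` bounding the distance to `N`. Truncating to the variables
`x_1, …, x_N` provides a starting point: for `n ≥ N` only the constant coefficient survives, and
`onZeros_mul` applies. -/
lemma regularValue_mul_eqUpTo (N d n : ℕ) (hN : N ≤ n + d) (v w : List ℕ) :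
    EqUpTo N (regularValue R n v * regularValue R n w)
      ((quasiShuffle v w).map (regularValue R n)).sum := by
  classical
  induction d generalizing n v w with
  | zero =>
    intro m hm
    rw [map_multiset_sum, Multiset.map_map]
    by_cases h : m = 0
    · subst h
      rw [MvPowerSeries.coeff_mul]
      simp only [Finsupp.antidiagonal_zero, Finset.sum_singleton, coeff_regularValue,
        Function.comp_def, iterCoeff_zero invSum_zero_right, onZeros_mul]
    · have h0 : ∀ m', m' ≠ 0 → m' ≤ m → ∀ u,
          MvPowerSeries.coeff m' (regularValue R n u) = 0 := fun m' h1 h2 u => by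
        have := maxIndex_mono h2
        rw [coeff_regularValue, iterCoeff_eq_zero h1 (by omega)]
      rw [MvPowerSeries.coeff_mul, Finset.sum_eq_zero, Multiset.sum_eq_zero]
      · intro x hx
        obtain ⟨u, _, rfl⟩ := Multiset.mem_map.mp hx
        exact h0 m h le_rfl u
      · intro p hp
        have hp := Finset.HasAntidiagonal.mem_antidiagonal.mp hp
        by_cases h1 : p.1 = 0
        · rw [h0 p.2 (fun h2 => h (by rw [← hp, h1, h2, add_zero]))
            (le_of_le_of_eq le_add_self hp), mul_zero]
        · rw [h0 p.1 h1 (le_of_le_of_eq le_self_add hp), zero_mul]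
  | succ d ih =>
    rcases v with _ | ⟨a, v⟩
    · simp [quasiShuffle_nil_left, regularValue_nil, EqUpTo]
    rcases w with _ | ⟨b, w⟩
    · simp [quasiShuffle_nil_right, regularValue_nil, EqUpTo]
    have h := ((ih (n + 1) (by omega) (a :: v) (b :: w)).add
      (((ih (n + 1) (by omega) v (b :: w)).mul_left
        (MvPowerSeries.monomial (Finsupp.single n.succPNat a) 1)).add
      ((ih (n + 1) (by omega) (a :: v) w).mul_left
        (MvPowerSeries.monomial (Finsupp.single n.succPNat b) 1)))).add
      ((ih (n + 1) (by omega) v w).mul_left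
        (MvPowerSeries.monomial (Finsupp.single n.succPNat (a + b)) 1))
    -- When both first indices equal `n + 1`, the letters merge to `a + b`: this is the third term
    -- of the quasi-shuffle recursion.
    have hab : MvPowerSeries.monomial (Finsupp.single n.succPNat (a + b)) (1 : R) =
        MvPowerSeries.monomial (Finsupp.single n.succPNat a) 1 *
          MvPowerSeries.monomial (Finsupp.single n.succPNat b) 1 := by
      rw [MvPowerSeries.monomial_mul_monomial, Finsupp.single_add, one_mul]
    convert h using 1
    · rw [regularValue_cons n a, regularValue_cons n b, hab]
      ring
    · rw [quasiShuffle_cons_cons]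
      simp only [Multiset.map_add, Multiset.sum_add, Multiset.map_map, Function.comp_def,
        regularValue_cons n, Multiset.sum_map_add, Multiset.sum_map_mul_left]
      ring

lemma regularValue_mul (v w : List ℕ) :
    regularValue R 0 v * regularValue R 0 w = ((quasiShuffle v w).map (regularValue R 0)).sum := by
  ext m
  exact regularValue_mul_eqUpTo (maxIndex m) (maxIndex m) 0 (by omega) v w m le_rfl

lemma iterCoeff_replicate_zero {ε : ℕ → R} {S : ℕ → ℕ → R} (n r : ℕ) {m : ℕ+ →₀ ℕ}
    (hm : m ≠ 0) : iterCoeff ε S n (List.replicate r 0) m = 0 := by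
  induction r generalizing n with
  | zero => simp [iterCoeff, hm]
  | succ r ih =>
    rw [List.replicate_succ, iterCoeff_cons_of_ne hm]
    simp [ih]

lemma regularValue_replicate {r : ℕ} (hr : r ≠ 0) :
    regularValue R 0 (List.replicate r 0) = 0 := by
  ext m
  rw [coeff_regularValue]
  by_cases h : m = 0
  · obtain ⟨s, rfl⟩ := Nat.exists_eq_succ_of_ne_zero hr
    rw [h, iterCoeff_zero invSum_zero_right, onZeros_replicate]
    simp [invSum]
  · rw [iterCoeff_replicate_zero _ _ h, map_zero]

/-- The last letter is positive, so the last and largest index belongs to a variable occurring in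
`x^m`; this bounds all indices. -/
lemma finite_indexSeqAbove {u : List ℕ} (hu : IsLeftWeak u) (n : ℕ) (m : ℕ+ →₀ ℕ) :
    Finite (IndexSeqAbove n (fun j => u.get j) m) := by
  have hle : ∀ (s : IndexSeqAbove n (fun j => u.get j) m) j, ((s.1 j : ℕ+) : ℕ) ≤ maxIndex m := by
    intro s j
    have hpos : 0 < u.length := by have := j.2; omega
    let l : Fin u.length := ⟨u.length - 1, by omega⟩
    have hl : 0 < u.get l := by
      refine hu _ ?_
      rw [List.getLast?_eq_getElem?]
      simp [l]
    have h1 : s.1 j ≤ s.1 l := s.1.monotone (by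
      have := j.2
      rw [Fin.le_def]
      show (j : ℕ) ≤ u.length - 1
      omega)
    refine (PNat.coe_le_coe _ _ |>.mpr h1).trans (le_maxIndex ?_)
    have h2 := DFunLike.congr_fun s.2.2 (s.1 l)
    rw [monomialExponent, Finsupp.finsetSum_apply] at h2
    rw [← h2]
    refine (lt_of_lt_of_le ?_ (Finset.single_le_sum (f := fun j =>
      (Finsupp.single (s.1 j) (u.get j)) (s.1 l)) (fun _ _ => Nat.zero_le _)
      (Finset.mem_univ l))).ne'
    simpa using hl
  let F : IndexSeqAbove n (fun j => u.get j) m → (Fin u.length → Fin (maxIndex m + 1)) :=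
    fun s j => ⟨s.1 j, Nat.lt_succ_of_le (hle s j)⟩
  refine Finite.of_injective F fun s t h => ?_
  ext j
  exact PNat.eq (congrArg Fin.val (congrFun h j))

lemma regularValue_eq_leftWeakMonomial {u : List ℕ} (hu : IsLeftWeak u) :
    regularValue R 0 u = leftWeakMonomial R u := by
  ext m
  -- A left weak word has only left weak tails and is never `0^{r+1}`, so the summation condition on
  -- zeros is vacuous and the values `invSum` do no harm.
  have h := hasSum_iterCoeff (ε := fun _ => 1) (χ := invSum fun _ => 1) id IsLeftWeak
    (fun a w h => h.of_cons) invSum_zero_right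
    (fun r n h => by
      have := h 0 (by rw [List.replicate_succ']; simp)
      omega)
    (fun W n m hW => by
      rw [List.map_id] at hW
      have : Finite (IndexSeqAbove n (fun j => id (W.get j)) m) := finite_indexSeqAbove hW n m
      exact Summable.of_finite) u 0 m (by simpa using hu)
  have : Finite (IndexSeqAbove 0 (fun j => id (u.get j)) m) := finite_indexSeqAbove hu 0 m
  have := Fintype.ofFinite (IndexSeqAbove 0 (fun j => id (u.get j)) m)
  have h2 := h.unique (hasSum_fintype _)
  rw [List.map_id] at h2
  -- The count was obtained in `ℂ`; it descends to `ℤ` by injectivity and is then mapped to `R`.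
  have h3 : iterCoeff (fun _ => (1 : ℤ)) (invSum fun _ => 1) 0 u m =
      (Nat.card (IndexSeq u.get m) : ℤ) := by
    apply Int.cast_injective (α := ℂ)
    have h4 := map_iterCoeff_one (Int.castRingHom ℂ) 0 u m
    rw [eq_intCast] at h4
    rw [h4, h2, Nat.card_congr (indexSeqEquiv u.get m)]
    simp only [Finset.prod_const_one, Finset.sum_const, nsmul_eq_mul, mul_one, Finset.card_univ,
      ← Nat.card_eq_fintype_card, Int.cast_natCast]
    rfl
  rw [coeff_regularValue, ← map_iterCoeff_one (Int.castRingHom R), h3]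
  simp [leftWeakMonomial, MvPowerSeries.coeff_apply]

lemma leftWeakMonomial_mem {u : List ℕ} (hu : IsLeftWeak u) :
    leftWeakMonomial R u ∈ LWQSym R := Submodule.subset_span ⟨u, hu, rfl⟩

/-- Induction on the number of trailing zeros. Since the character kills `0^r`, multiplicativity
applied to `u` and `0^r` expresses the value on `u0^r` through words with fewer trailing zeros. -/
lemma regularValue_mem (w : List ℕ) : regularValue R 0 w ∈ LWQSym R := by
  obtain ⟨u, r, hu, rfl⟩ := exists_eq_append_replicate w
  induction r using Nat.strong_induction_on generalizing u with
  | _ r ih =>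
    rcases Nat.eq_zero_or_pos r with rfl | hr
    · simpa [regularValue_eq_leftWeakMonomial hu] using leftWeakMonomial_mem hu
    by_cases h : u = []
    · simp [h, regularValue_replicate hr.ne']
    obtain ⟨Γ, h1, h2⟩ := quasiShuffle_replicate h hu r
    have h3 := regularValue_mul (R := R) u (List.replicate r 0)
    rw [regularValue_replicate hr.ne', mul_zero, h1, Multiset.map_add, Multiset.sum_add,
      Multiset.map_singleton, Multiset.sum_singleton] at h3
    rw [eq_neg_of_add_eq_zero_left h3.symm]
    refine neg_mem (multiset_sum_mem _ fun F hF => ?_)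
    obtain ⟨w, hw, rfl⟩ := Multiset.mem_map.mp hF
    obtain ⟨u', s, _, hu', hs, rfl⟩ := h2 w hw
    exact ih s hs u' hu'

lemma LWQSym_eq_span : LWQSym R = Submodule.span R (Set.range (regularValue R 0)) := by
  refine le_antisymm (Submodule.span_le.mpr ?_) (Submodule.span_le.mpr ?_)
  · rintro _ ⟨u, hu, rfl⟩
    exact Submodule.subset_span ⟨u, regularValue_eq_leftWeakMonomial hu⟩
  · rintro _ ⟨w, rfl⟩
    exact regularValue_mem w

variable (R) in
/-- The subalgebra of left weak quasisymmetric functions. -/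
noncomputable def leftWeakSubalgebra : Subalgebra R (MvPowerSeries ℕ+ R) :=
  (LWQSym R).toSubalgebra
    (by
      rw [← regularValue_nil (R := R) 0]
      exact regularValue_mem [])
    (by
      intro F G hF hG
      rw [LWQSym_eq_span] at hF hG
      have h := Submodule.mul_mem_mul hF hG
      rw [Submodule.span_mul_span] at h
      refine Submodule.span_le.mpr ?_ h
      rintro _ ⟨_, ⟨v, rfl⟩, _, ⟨w, rfl⟩, rfl⟩
      dsimp only
      rw [regularValue_mul]
      refine multiset_sum_mem _ fun F hF => ?_
      obtain ⟨u, _, rfl⟩ := Multiset.mem_map.mp hF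
      exact regularValue_mem u)

end Characters

/-! ### Formal exponentials of integrals, and Newton's identities. -/

section LogarithmicDerivative

open PowerSeries

variable {D : Type*} [CommRing D]

/-- The coefficients of the power series with constant term `1` and logarithmic derivative
`∑ L r y^r`. -/
def expInt [Algebra ℚ D] (L : ℕ → D) : ℕ → D
  | 0 => 1
  | r + 1 => (1 / (r + 1) : ℚ) • ∑ j : Fin (r + 1), L j * expInt L (r - j)

section

variable [Algebra ℚ D]

lemma expInt_zero (L : ℕ → D) : expInt L 0 = 1 := by rw [expInt]

lemma expInt_succ (L : ℕ → D) (r : ℕ) :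
    expInt L (r + 1) =
      (1 / (r + 1) : ℚ) • ∑ p ∈ Finset.HasAntidiagonal.antidiagonal r, L p.1 * expInt L p.2 := by
  rw [expInt, Finset.Nat.sum_antidiagonal_eq_sum_range_succ (fun i j => L i * expInt L j),
    Fin.sum_univ_eq_sum_range (fun j => L j * expInt L (r - j))]

lemma derivative_expInt (L : ℕ → D) :
    derivative D (mk (expInt L)) = mk L * mk (expInt L) := by
  ext r
  have h : ((r : D) + 1) = algebraMap ℚ D (r + 1) := by simp
  rw [coeff_derivative, coeff_mul, coeff_mk, expInt_succ, mul_comm, h, ← Algebra.smul_def,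
    smul_smul, mul_one_div_cancel (by positivity), one_smul]
  simp

lemma eq_expInt_of_derivative {L : ℕ → D} {F : PowerSeries D} (h0 : constantCoeff F = 1)
    (h : derivative D F = mk L * F) (r : ℕ) : coeff r F = expInt L r := by
  induction r using Nat.strong_induction_on with
  | _ r ih =>
    cases r with
    | zero => rw [coeff_zero_eq_constantCoeff_apply, h0, expInt_zero]
    | succ r =>
      have h1 := congrArg (coeff r) h
      have h2 : ((r : D) + 1) = algebraMap ℚ D (r + 1) := by simp
      rw [coeff_derivative, coeff_mul, mul_comm, h2, ← Algebra.smul_def] at h1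
      have h4 : coeff (r + 1) F = (1 / (r + 1) : ℚ) • ((r + 1 : ℚ) • coeff (r + 1) F) := by
        rw [smul_smul, one_div_mul_cancel (by positivity), one_smul]
      rw [expInt_succ, h4, h1]
      have h3 : ∀ p ∈ Finset.HasAntidiagonal.antidiagonal r,
          coeff p.1 (mk L) * coeff p.2 F = L p.1 * expInt L p.2 := fun p hp => by
        have := Finset.HasAntidiagonal.mem_antidiagonal.mp hp
        rw [coeff_mk, ih p.2 (by omega)]
      rw [Finset.sum_congr rfl h3]

lemma map_expInt {D' : Type*} [CommRing D'] [Algebra ℚ D'] (φ : D →+* D') (L : ℕ → D) (r : ℕ) :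
    φ (expInt L r) = expInt (fun j => φ (L j)) r := by
  induction r using Nat.strong_induction_on with
  | _ r ih =>
    cases r with
    | zero => simp [expInt_zero]
    | succ r =>
      rw [expInt_succ, expInt_succ, map_rat_smul φ, map_sum]
      congr 1
      refine Finset.sum_congr rfl fun p hp => ?_
      have := Finset.HasAntidiagonal.mem_antidiagonal.mp hp
      rw [map_mul, ih p.2 (by omega)]

/-- The binomial series. -/
lemma expInt_alternating (c : D) (r : ℕ) :
    ((r : D) + 1) * expInt (fun j => (-1) ^ j * c) (r + 1) =
      (c - r) * expInt (fun j => (-1) ^ j * c) r := by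
  set L : ℕ → D := fun j => (-1) ^ j * c
  have h1 : mk L * (1 + X) = C c := by
    ext n
    rw [mul_add, mul_one, map_add]
    cases n with
    | zero => simp [L]
    | succ n =>
      rw [coeff_succ_mul_X, coeff_C]
      simp [L, pow_succ]
  have h2 : derivative D (mk (expInt L)) * (1 + X) = C c * mk (expInt L) := by
    rw [derivative_expInt, ← h1]; ring
  have h3 := congrArg (coeff r) h2
  rw [mul_add, mul_one, map_add, coeff_C_mul, coeff_derivative, coeff_mk, coeff_mk] at h3
  cases r with
  | zero => simp at h3 ⊢; simpa using h3
  | succ r =>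
    rw [coeff_succ_mul_X, coeff_derivative, coeff_mk] at h3
    push_cast at h3 ⊢
    linear_combination h3

end

/-- Newton's identities for the elementary symmetric functions of a geometric progression. -/
lemma derivative_geometric [NoZeroDivisors D] {q u : D} {x L : ℕ → D}
    (hq : ∀ r : ℕ, 1 - q ^ (r + 1) ≠ 0)
    (hx : ∀ r, x (r + 1) * (1 - q ^ (r + 1)) = u * q ^ (r + 1) * x r)
    (hL : ∀ r, L r * (1 - q ^ (r + 1)) = (-1) ^ r * (u * q) ^ (r + 1)) :
    derivative D (mk x) = mk L * mk x := by
  -- This is the functional equation of `∏_{i≥1} (1 + u q^i y)`: replacing `y` by `qy` drops the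
  -- first factor.
  have h1 : mk x = rescale q (mk x) * (1 + C (u * q) * X) := by
    ext r
    rw [mul_add, mul_one, map_add, mul_left_comm, ← mul_assoc]
    cases r with
    | zero =>
      rw [coeff_zero_mul_X, coeff_rescale]
      simp
    | succ r =>
      rw [coeff_succ_mul_X, coeff_C_mul]
      simp only [coeff_rescale, coeff_mk]
      linear_combination hx r
  have h2 : (mk L - C q * rescale q (mk L)) * (1 + C (u * q) * X) = C (u * q) := by
    ext r
    rw [mul_add, mul_one, map_add, mul_left_comm, ← mul_assoc]
    cases r with
    | zero =>
      have := hL 0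
      rw [coeff_zero_mul_X, map_sub, coeff_C_mul, coeff_rescale]
      simp at this ⊢
      linear_combination this
    | succ r =>
      rw [coeff_succ_mul_X, coeff_C_mul, coeff_C]
      simp only [map_sub, coeff_C_mul, coeff_rescale, coeff_mk]
      have h3 := hL r
      have h4 := hL (r + 1)
      simp only [Nat.add_eq_zero_iff, one_ne_zero, and_false, if_false]
      linear_combination h4 + u * q * h3
  have h3 : derivative D (rescale q (mk x)) = C q * rescale q (derivative D (mk x)) := by
    ext r
    simp only [coeff_derivative, coeff_rescale, coeff_C_mul]
    ring
  have h4 : derivative D (mk x) = C q * rescale q (derivative D (mk x)) * (1 + C (u * q) * X) +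
      rescale q (mk x) * C (u * q) := by
    conv_lhs => rw [h1]
    rw [Derivation.leibniz, h3]
    simp
    ring
  -- The defect satisfies `W(y) = q W(qy) (1 + uqy)`. Comparing coefficients, each is multiplied by
  -- some `1 - q^{r+1} ≠ 0` and determined by its predecessor, so all vanish.
  set W := derivative D (mk x) - mk L * mk x with hW
  have h5 : W = C q * rescale q W * (1 + C (u * q) * X) := by
    rw [hW, map_sub, map_mul]
    linear_combination h4 - mk L * h1 - rescale q (mk x) * h2
  have h6 : ∀ r, coeff r W = 0 := by
    intro r
    induction r with
    | zero =>
      have h := congrArg (coeff 0) h5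
      rw [mul_add, mul_one, map_add, ← mul_assoc, coeff_zero_mul_X, coeff_C_mul,
        coeff_rescale] at h
      have : coeff 0 W * (1 - q ^ (0 + 1)) = 0 := by linear_combination h
      exact (mul_eq_zero.mp this).resolve_right (hq 0)
    | succ r ih =>
      have h := congrArg (coeff (r + 1)) h5
      rw [mul_add, mul_one, map_add, mul_left_comm, ← mul_assoc, coeff_succ_mul_X] at h
      simp only [coeff_C_mul, coeff_rescale, ih, mul_zero, add_zero] at h
      have : coeff (r + 1) W * (1 - q ^ (r + 1 + 1)) = 0 := by linear_combination h
      exact (mul_eq_zero.mp this).resolve_right (hq _)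
  exact sub_eq_zero.mp (by ext r; exact h6 r)

end LogarithmicDerivative

/-! ### The geometric series `e^{cz} / (1 - e^{cz})` through Bernoulli numbers. -/

section GeometricSeries

open PowerSeries

/-- The power series `z e^{cz} / (1 - e^{cz})`. -/
noncomputable def geomSeries (c : ℚ) : PowerSeries ℚ :=
  C (-1 / c) * rescale c (bernoulliPowerSeries ℚ) * rescale c (exp ℚ)

lemma geomSeries_mul {c : ℚ} (hc : c ≠ 0) :
    geomSeries c * (1 - rescale c (exp ℚ)) = X * rescale c (exp ℚ) := by
  have h := congrArg (rescale c) (bernoulliPowerSeries_mul_exp_sub_one ℚ)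
  rw [map_mul, map_sub, map_one, rescale_X] at h
  have h2 : C (-1 / c) * C c = (-1 : PowerSeries ℚ) := by
    rw [← map_mul, div_mul_cancel₀ _ hc]; simp
  rw [geomSeries]
  linear_combination (-C (-1 / c) * rescale c (exp ℚ)) * h - X * rescale c (exp ℚ) * h2

lemma coeff_zero_geomSeries (c : ℚ) : coeff 0 (geomSeries c) = -1 / c := by
  simp only [geomSeries, coeff_zero_eq_constantCoeff_apply, map_mul, constantCoeff_C]
  simp only [← coeff_zero_eq_constantCoeff_apply, coeff_rescale]
  simp [bernoulliPowerSeries]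

/-- Independence of `c` is the point: this is the source of the constant `-1/2` in `M_{(0)}`. -/
lemma coeff_one_geomSeries {c : ℚ} (hc : c ≠ 0) : coeff 1 (geomSeries c) = -1 / 2 := by
  rw [geomSeries, mul_assoc, coeff_C_mul, coeff_mul]
  simp [Finset.Nat.antidiagonal_succ, coeff_rescale, bernoulliPowerSeries]
  field_simp
  norm_num

/-- The power series `z^r ∏_{s=1}^r e^{sdz} / (1 - e^{sdz})`. -/
noncomputable def zerosSeries (d : ℚ) (r : ℕ) : PowerSeries ℚ :=
  ∏ s ∈ Finset.range r, geomSeries ((s + 1) * d)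

lemma zerosSeries_zero (d : ℚ) : zerosSeries d 0 = 1 := by simp [zerosSeries]

lemma zerosSeries_succ (d : ℚ) (r : ℕ) :
    zerosSeries d (r + 1) = zerosSeries d r * geomSeries ((r + 1) * d) := by
  simp [zerosSeries, Finset.prod_range_succ]

end GeometricSeries

/-! ### Birkhoff factorization on words of zeros. -/

section ZerosLaurent

variable (A : Type*) [CommRing A] [Algebra ℚ A]

/-- Power series with rational coefficients as Laurent series over `A`. -/
noncomputable def ratToLaurent : PowerSeries ℚ →+* LaurentSeries A :=
  (HahnSeries.ofPowerSeries ℤ A).comp (PowerSeries.map (algebraMap ℚ A))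

lemma ratToLaurent_apply (f : PowerSeries ℚ) :
    ratToLaurent A f = HahnSeries.ofPowerSeries ℤ A (PowerSeries.map (algebraMap ℚ A) f) := rfl

/-- The Laurent series `z⁻¹`. -/
noncomputable def zInv : LaurentSeries A := HahnSeries.single (-1) 1

variable {A}

omit [Algebra ℚ A] in
lemma zInv_mul_X : zInv A * HahnSeries.ofPowerSeries ℤ A PowerSeries.X = 1 := by
  rw [zInv, HahnSeries.ofPowerSeries_X, HahnSeries.single_mul_single]
  simp

lemma algebraMap_rat_laurent (c : ℚ) :
    algebraMap ℚ (LaurentSeries A) c = HahnSeries.C (algebraMap ℚ A c) :=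
  RingHom.congr_fun (Subsingleton.elim (algebraMap ℚ (LaurentSeries A))
    (HahnSeries.C.comp (algebraMap ℚ A))) c

/-- The power series `e^{τdz}`. -/
noncomputable def expShift (τ : A) (d : ℚ) : PowerSeries A :=
  PowerSeries.rescale (d • τ) (PowerSeries.exp A)

lemma expShift_pow (τ : A) (d : ℚ) (n : ℕ) :
    expShift τ d ^ n = PowerSeries.rescale (n * (d • τ)) (PowerSeries.exp A) := by
  rw [expShift, ← map_pow, PowerSeries.exp_pow_eq_rescale_exp, PowerSeries.rescale_rescale]

/-- The regularized sum for the word `0^r`, in the direction `(d, …, d)` and with `t = τ`. -/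
noncomputable def zerosLaurent (τ : A) (d : ℚ) (r : ℕ) : LaurentSeries A :=
  (zInv A * HahnSeries.ofPowerSeries ℤ A (expShift τ d)) ^ r * ratToLaurent A (zerosSeries d r)

/-- `z e^{rτdz} e^{rdz} / (1 - e^{rdz})`, with `r` replaced by `r + 1`. -/
noncomputable def powerSumSeries (τ : A) (d : ℚ) (r : ℕ) : PowerSeries A :=
  expShift τ d ^ (r + 1) * PowerSeries.map (algebraMap ℚ A) (geomSeries ((r + 1) * d))

/-- The regular part of `e^{rτdz} e^{rdz} / (1 - e^{rdz})`, with `r` replaced by `r + 1`. -/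
noncomputable def powerSumRegular (τ : A) (d : ℚ) (r : ℕ) : PowerSeries A :=
  PowerSeries.mk fun n => PowerSeries.coeff (n + 1) (powerSumSeries τ d r)

lemma coeff_expShift_pow (τ : A) (d : ℚ) (n i : ℕ) :
    PowerSeries.coeff i (expShift τ d ^ n) =
      (n * (d • τ)) ^ i * algebraMap ℚ A (1 / i.factorial) := by
  rw [expShift_pow, PowerSeries.coeff_rescale, PowerSeries.coeff_exp]

/-- The linear term `(r+1)dτ` of the exponential meets the residue `-1/((r+1)d)`, so that `r` and
`d` cancel. Hence the renormalized values depend neither on `δ` nor, up to sign, on which power sum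
is taken. -/
lemma constantCoeff_powerSumRegular (τ : A) {d : ℚ} (hd : 0 < d) (r : ℕ) :
    PowerSeries.constantCoeff (powerSumRegular τ d r) = -τ - algebraMap ℚ A (1 / 2) := by
  have hr : ((r : ℚ) + 1) * d ≠ 0 := by positivity
  have h : ((r + 1 : ℕ) : A) * (d • τ) * algebraMap ℚ A (-1 / ((r + 1) * d)) = -τ := by
    have h1 : ((r + 1 : ℕ) : A) = algebraMap ℚ A (r + 1) := by simp
    rw [h1, Algebra.smul_def, ← mul_assoc, ← map_mul, mul_right_comm, ← map_mul,
      mul_div_cancel₀ _ hr]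
    simp
  have h2 : PowerSeries.coeff 1 (powerSumSeries τ d r) =
      algebraMap ℚ A (-1 / 2) +
        ((r + 1 : ℕ) : A) * (d • τ) * algebraMap ℚ A (-1 / ((r + 1) * d)) := by
    rw [powerSumSeries, PowerSeries.coeff_mul, Finset.Nat.sum_antidiagonal_succ,
      Finset.Nat.antidiagonal_zero, Finset.sum_singleton]
    simp only [PowerSeries.coeff_map, coeff_expShift_pow, zero_add, coeff_one_geomSeries hr,
      coeff_zero_geomSeries]
    simp
  rw [← PowerSeries.coeff_zero_eq_constantCoeff_apply, powerSumRegular, PowerSeries.coeff_mk,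
    zero_add, h2, h, neg_div, map_neg]
  ring

lemma ofPowerSeries_powerSumRegular (τ : A) (d : ℚ) (r : ℕ) :
    HahnSeries.ofPowerSeries ℤ A (powerSumRegular τ d r) =
      zInv A * HahnSeries.ofPowerSeries ℤ A (powerSumSeries τ d r) +
        algebraMap ℚ (LaurentSeries A) (1 / ((r + 1) * d)) * zInv A := by
  have h := PowerSeries.eq_X_mul_shift_add_const (powerSumSeries τ d r)
  have h0 : PowerSeries.constantCoeff (powerSumSeries τ d r) =
      algebraMap ℚ A (-1 / ((r + 1) * d)) := by
    rw [powerSumSeries, map_mul, ← PowerSeries.coeff_zero_eq_constantCoeff_apply,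
      ← PowerSeries.coeff_zero_eq_constantCoeff_apply, PowerSeries.coeff_map, coeff_expShift_pow,
      coeff_zero_geomSeries]
    simp
  have h1 : HahnSeries.ofPowerSeries ℤ A (PowerSeries.C (algebraMap ℚ A (-1 / ((r + 1) * d)))) =
      -algebraMap ℚ (LaurentSeries A) (1 / ((r + 1) * d)) := by
    rw [HahnSeries.ofPowerSeries_C, neg_div, map_neg, map_neg, algebraMap_rat_laurent]
  rw [h0] at h
  have h2 := congrArg (fun F => zInv A * HahnSeries.ofPowerSeries ℤ A F) h
  simp only [map_add, map_mul, h1] at h2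
  rw [h2, powerSumRegular]
  linear_combination (-HahnSeries.ofPowerSeries ℤ A (PowerSeries.mk fun n =>
    PowerSeries.coeff (n + 1) (powerSumSeries τ d r))) * zInv_mul_X (A := A)

/-- This is `derivative_geometric` with `q = e^{dz}` and `u = e^{τdz}`; the factors `z` that clear
denominators cancel against `zInv`. -/
lemma derivative_zerosLaurent [NoZeroDivisors A] [Nontrivial A] (τ : A) {d : ℚ} (hd : 0 < d) :
    PowerSeries.derivative _ (PowerSeries.mk (zerosLaurent τ d)) =
      PowerSeries.mk (fun r => (-1) ^ r *
        (zInv A * HahnSeries.ofPowerSeries ℤ A (powerSumSeries τ d r))) *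
      PowerSeries.mk (zerosLaurent τ d) := by
  have hexp : ∀ r : ℕ, ratToLaurent A (PowerSeries.rescale d (PowerSeries.exp ℚ)) ^ (r + 1) =
      ratToLaurent A (PowerSeries.rescale ((r + 1) * d) (PowerSeries.exp ℚ)) := fun r => by
    rw [← map_pow, ← map_pow, PowerSeries.exp_pow_eq_rescale_exp, PowerSeries.rescale_rescale]
    push_cast
    rfl
  have hX : ∀ r : ℕ, ratToLaurent A (geomSeries ((r + 1) * d)) *
      (1 - ratToLaurent A (PowerSeries.rescale d (PowerSeries.exp ℚ)) ^ (r + 1)) =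
      HahnSeries.ofPowerSeries ℤ A PowerSeries.X *
        ratToLaurent A (PowerSeries.rescale d (PowerSeries.exp ℚ)) ^ (r + 1) := fun r => by
    rw [hexp, ← map_one (ratToLaurent A), ← map_sub, ← map_mul, geomSeries_mul (by positivity),
      map_mul, ratToLaurent_apply A PowerSeries.X, PowerSeries.map_X]
  refine derivative_geometric (q := ratToLaurent A (PowerSeries.rescale d (PowerSeries.exp ℚ)))
    (u := HahnSeries.ofPowerSeries ℤ A (expShift τ d)) (fun r h => ?_) (fun r => ?_) (fun r => ?_)
  -- The series `1 - e^{(r+1)dz}` is nonzero because its coefficient of `z` is `-(r+1)d`.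
  · rw [hexp, ← map_one (ratToLaurent A), ← map_sub, ratToLaurent_apply] at h
    have h2 := congrArg (PowerSeries.coeff 1)
      (HahnSeries.ofPowerSeries_injective (h.trans (map_zero _).symm))
    have h3 : ((r : ℚ) + 1) * d ≠ 0 := by positivity
    rw [PowerSeries.coeff_map, map_sub, PowerSeries.coeff_rescale, PowerSeries.coeff_exp,
      map_zero (PowerSeries.coeff 1), ← map_zero (algebraMap ℚ A)] at h2
    have h4 := (algebraMap ℚ A).injective h2
    simp only [PowerSeries.coeff_one, one_ne_zero, if_false, pow_one, Nat.factorial_one,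
      Nat.cast_one, div_one, eq_ratCast, Rat.cast_one, mul_one, zero_sub, neg_eq_zero] at h4
    exact h3 h4
  · rw [zerosLaurent, zerosLaurent, zerosSeries_succ, map_mul, pow_succ]
    linear_combination (zInv A * HahnSeries.ofPowerSeries ℤ A (expShift τ d)) ^ r *
      (zInv A * HahnSeries.ofPowerSeries ℤ A (expShift τ d)) * ratToLaurent A (zerosSeries d r) *
      hX r + HahnSeries.ofPowerSeries ℤ A (expShift τ d) *
      ratToLaurent A (PowerSeries.rescale d (PowerSeries.exp ℚ)) ^ (r + 1) *
      (zInv A * HahnSeries.ofPowerSeries ℤ A (expShift τ d)) ^ r *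
      ratToLaurent A (zerosSeries d r) * zInv_mul_X (A := A)
  · rw [powerSumSeries, map_mul, map_pow, mul_pow, ← ratToLaurent_apply]
    linear_combination (-1) ^ r * zInv A * HahnSeries.ofPowerSeries ℤ A (expShift τ d) ^ (r + 1) *
      hX r + (-1) ^ r * HahnSeries.ofPowerSeries ℤ A (expShift τ d) ^ (r + 1) *
      ratToLaurent A (PowerSeries.rescale d (PowerSeries.exp ℚ)) ^ (r + 1) * zInv_mul_X (A := A)

variable (A) in
/-- The values of the Birkhoff factor `φ₋` on the words `0^r`. -/
noncomputable def zerosMinus (d : ℚ) : ℕ → LaurentSeries A :=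
  expInt fun r => algebraMap ℚ (LaurentSeries A) ((-1) ^ r * (1 / ((r + 1) * d))) * zInv A

/-- The values of the Birkhoff factor `φ₊` on the words `0^r`. -/
noncomputable def zerosPlus (τ : A) (d : ℚ) : ℕ → PowerSeries A :=
  expInt fun r => (-1) ^ r * powerSumRegular τ d r

/-- The case `r = 0`, `n > 0` is included for the induction: each step multiplies by `z⁻¹`, so that
coefficient `n` comes from coefficients `n + 1 > 0`. -/
lemma coeff_zerosMinus_of_pos (d : ℚ) (r : ℕ) {n : ℤ} (hn : 0 ≤ n) (h : 0 < n ∨ 0 < r) :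
    (zerosMinus A d r).coeff n = 0 := by
  induction r using Nat.strong_induction_on generalizing n with
  | _ r ih =>
    cases r with
    | zero =>
      rw [zerosMinus, expInt_zero, HahnSeries.coeff_one, if_neg]
      rcases h with h | h <;> omega
    | succ r =>
      rw [zerosMinus, expInt_succ, Algebra.smul_def, algebraMap_rat_laurent, HahnSeries.C_apply,
        HahnSeries.coeff_single_mul, HahnSeries.coeff_sum, Finset.sum_eq_zero, mul_zero]
      intro p hp
      have := Finset.HasAntidiagonal.mem_antidiagonal.mp hp
      rw [mul_assoc, algebraMap_rat_laurent, HahnSeries.C_apply, HahnSeries.coeff_single_mul,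
        show zInv A = HahnSeries.single (-1) 1 from rfl, HahnSeries.coeff_single_mul]
      have h1 := ih p.2 (by omega) (n := n - 0 - 0 - -1) (by omega) (Or.inl (by omega))
      rw [zerosMinus, show zInv A = HahnSeries.single (-1) 1 from rfl] at h1
      rw [h1, mul_zero, mul_zero]

lemma coeff_zerosMinus (d : ℚ) (r : ℕ) {n : ℤ} (hn : 0 ≤ n) :
    (zerosMinus A d (r + 1)).coeff n = 0 :=
  coeff_zerosMinus_of_pos d (r + 1) hn (Or.inr r.succ_pos)

/-- Logarithmic derivatives add, and that of `zerosMinus` cancels the poles of that of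
`zerosLaurent`. The product is thus the formal exponential of a regular series. -/
lemma sum_zerosLaurent_mul_zerosMinus [NoZeroDivisors A] [Nontrivial A] (τ : A) {d : ℚ}
    (hd : 0 < d) (r : ℕ) :
    ∑ p ∈ Finset.HasAntidiagonal.antidiagonal r, zerosLaurent τ d p.1 * zerosMinus A d p.2 =
      HahnSeries.ofPowerSeries ℤ A (zerosPlus τ d r) := by
  have h1 := derivative_zerosLaurent τ hd
  have h2 := derivative_expInt fun r : ℕ =>
    algebraMap ℚ (LaurentSeries A) ((-1) ^ r * (1 / ((r + 1) * d))) * zInv A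
  have h3 : (PowerSeries.mk fun r : ℕ => (-1) ^ r *
        (zInv A * HahnSeries.ofPowerSeries ℤ A (powerSumSeries τ d r))) +
      (PowerSeries.mk fun r : ℕ =>
        algebraMap ℚ (LaurentSeries A) ((-1) ^ r * (1 / ((r + 1) * d))) * zInv A) =
      PowerSeries.mk fun r : ℕ =>
        HahnSeries.ofPowerSeries ℤ A ((-1) ^ r * powerSumRegular τ d r) := by
    ext1 r
    rw [map_add, PowerSeries.coeff_mk, PowerSeries.coeff_mk, PowerSeries.coeff_mk,
      map_mul (HahnSeries.ofPowerSeries ℤ A), ofPowerSeries_powerSumRegular,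
      map_mul (algebraMap ℚ (LaurentSeries A))]
    simp only [map_pow, map_neg, map_one]
    ring
  have h4 : PowerSeries.derivative _ (PowerSeries.mk (zerosLaurent τ d) *
      PowerSeries.mk (zerosMinus A d)) = (PowerSeries.mk fun r : ℕ =>
        HahnSeries.ofPowerSeries ℤ A ((-1) ^ r * powerSumRegular τ d r)) *
      (PowerSeries.mk (zerosLaurent τ d) * PowerSeries.mk (zerosMinus A d)) := by
    rw [Derivation.leibniz, h1, zerosMinus, h2, ← h3]
    simp only [smul_eq_mul]
    ring
  have h5 := eq_expInt_of_derivative (by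
    rw [map_mul, ← PowerSeries.coeff_zero_eq_constantCoeff_apply,
      ← PowerSeries.coeff_zero_eq_constantCoeff_apply, PowerSeries.coeff_mk, PowerSeries.coeff_mk]
    simp [zerosLaurent, zerosSeries_zero, zerosMinus, expInt_zero]) h4 r
  rw [← map_expInt, PowerSeries.coeff_mul] at h5
  simpa [zerosPlus] using h5

lemma constantCoeff_zerosPlus (τ : A) {d : ℚ} (hd : 0 < d) (r : ℕ) :
    PowerSeries.constantCoeff (zerosPlus τ d r) =
      expInt (fun j => (-1) ^ j * (-τ - algebraMap ℚ A (1 / 2))) r := by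
  rw [zerosPlus, map_expInt]
  simp [constantCoeff_powerSumRegular τ hd]

end ZerosLaurent

/-! ### Birkhoff factorization in a constant direction. -/

section Birkhoff

/-- The weak composition `α` in the direction `(δ, …, δ)`. -/
abbrev constWord (δ : ℕ+) (α : List ℕ) : DirectedWord := α.map fun a => (a, δ)

lemma polarPart_sub (F G : Target) : polarPart (F - G) = polarPart F - polarPart G := by
  refine HahnSeries.ext (funext fun n => ?_)
  simp only [polarPart, HahnSeries.coeff_truncLT, HahnSeries.coeff_sub]
  split_ifs <;> simp

lemma polarPart_ofPowerSeries (p : PowerSeries (Polynomial (MvPowerSeries ℕ+ ℚ))) :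
    polarPart (HahnSeries.ofPowerSeries ℤ _ p) = 0 := by
  refine HahnSeries.ext (funext fun n => ?_)
  rw [polarPart, HahnSeries.coeff_truncLT, HahnSeries.coeff_zero]
  split_ifs with hn
  · rw [PowerSeries.coeff_coe, if_pos hn]
  · rfl

lemma polarPart_eq_self {F : Target} (h : ∀ n, 0 ≤ n → F.coeff n = 0) : polarPart F = F := by
  refine HahnSeries.ext (funext fun n => ?_)
  rw [polarPart, HahnSeries.coeff_truncLT]
  split_ifs with hn
  · rfl
  · exact (h n (not_lt.mp hn)).symm

/-- The recursion omits from `φ ⋆ ψ` only the cut with empty left part. The bound on lengths makes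
this usable within the induction that identifies `φ₋`. -/
lemma birkhoff_sum {φ ψ : List ℕ → Target} {δ : ℕ+} (hφ : φ [] = 1) (hψ : ψ [] = 1) (a : ℕ)
    (l : List ℕ) (hreg : ∀ α, regularization (constWord δ α) = φ α)
    (hminus : ∀ α : List ℕ, α.length ≤ l.length → birkhoffMinus (constWord δ α) = ψ α) :
    regularization (constWord δ (a :: l)) + ∑ i : Fin (constWord δ l).length,
        regularization ((a, δ) :: (constWord δ l).take i) *
          birkhoffMinus ((constWord δ l).drop i) =
      conv φ ψ (a :: l) - ψ (a :: l) := by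
  have h1 : ∀ i, regularization ((a, δ) :: (constWord δ l).take i) = φ (a :: l.take i) :=
    fun i => by rw [← hreg, constWord, constWord, List.map_cons, List.map_take]
  have h2 : ∀ i, birkhoffMinus ((constWord δ l).drop i) = ψ (l.drop i) := fun i => by
    rw [← hminus _ (by simp), constWord, constWord, List.map_drop]
  simp only [h1, h2, hreg]
  rw [Fin.sum_univ_eq_sum_range (fun i => φ (a :: l.take i) * ψ (l.drop i)), conv_eq_sum_range,
    List.length_map, List.length_cons, Finset.sum_range_succ, Finset.sum_range_succ']
  simp [hφ, hψ]
  ring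

/-- The Birkhoff factorization of a convolution of a regular form with a form supported on the
words `0^r`. -/
theorem birkhoff_eq_conv {δ : ℕ+}
    {Q : List ℕ → PowerSeries (Polynomial (MvPowerSeries ℕ+ ℚ))} (hQ : Q [] = 1)
    {x m : ℕ → Target} {p : ℕ → PowerSeries (Polynomial (MvPowerSeries ℕ+ ℚ))}
    (hx : x 0 = 1) (hm : m 0 = 1) (hpolar : ∀ r n, 0 ≤ n → (m (r + 1)).coeff n = 0)
    (hp : ∀ r, ∑ c ∈ Finset.HasAntidiagonal.antidiagonal r, x c.1 * m c.2 =
      HahnSeries.ofPowerSeries ℤ _ (p r))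
    (hreg : ∀ α, regularization (constWord δ α) =
      conv (fun v => HahnSeries.ofPowerSeries ℤ _ (Q v)) (onZeros x) α) (α : List ℕ) :
    birkhoffMinus (constWord δ α) = onZeros m α ∧
      birkhoffPlus (constWord δ α) = HahnSeries.ofPowerSeries ℤ _ (conv Q (onZeros p) α) := by
  have hφ : conv (fun v => HahnSeries.ofPowerSeries ℤ _ (Q v)) (onZeros x) [] = 1 := by
    simp [conv, hQ, onZeros_nil, hx]
  have hψ : onZeros m [] = 1 := by rw [onZeros_nil, hm]
  have hconv : ∀ α, conv (conv (fun v => HahnSeries.ofPowerSeries ℤ _ (Q v)) (onZeros x))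
      (onZeros m) α = HahnSeries.ofPowerSeries ℤ _ (conv Q (onZeros p) α) := fun α => by
    refine (conv_assoc _ _ _ _).trans (Eq.trans ?_ (map_conv (R' := Target)
      (HahnSeries.ofPowerSeries ℤ _) Q (onZeros p) α).symm)
    refine conv_congr (fun _ => rfl) (fun v => ?_) α
    rw [conv_onZeros, funext hp]
    unfold onZeros
    split_ifs <;> simp
  have hpol : ∀ (a : ℕ) l, polarPart (onZeros m (a :: l)) = onZeros m (a :: l) := fun a l => by
    refine polarPart_eq_self fun n hn => ?_
    unfold onZeros
    split_ifs
    · exact hpolar _ n hn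
    · rfl
  have hminus : ∀ α, birkhoffMinus (constWord δ α) = onZeros m α := by
    intro α
    induction hl : α.length using Nat.strong_induction_on generalizing α with
    | _ n ih =>
      cases α with
      | nil => rw [hψ, constWord, List.map_nil, birkhoffMinus]
      | cons a l =>
        have h := birkhoff_sum hφ hψ a l hreg (fun β hβ => ih β.length (by
          rw [List.length_cons] at hl; omega) β rfl)
        rw [constWord, List.map_cons] at h ⊢
        -- With `ψ = onZeros m`, the series `φ ⋆ ψ` is regular and `ψ` is purely polar on nonempty
        -- words, so `-P(φ ⋆ ψ - ψ) = ψ`.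
        rw [birkhoffMinus, h, hconv, polarPart_sub, polarPart_ofPowerSeries, hpol]
        abel
  refine ⟨hminus α, ?_⟩
  cases α with
  | nil => rw [constWord, List.map_nil, birkhoffPlus, ← hconv, conv, hφ, hψ, mul_one]
  | cons a l =>
    have h := birkhoff_sum hφ hψ a l hreg (fun β _ => hminus β)
    rw [constWord, List.map_cons] at h ⊢
    rw [birkhoffPlus]
    simp only [h]
    rw [hconv, polarPart_sub, polarPart_ofPowerSeries, hpol]
    ring

end Birkhoff

/-! ### Convergent power series and the identity theorem. -/

section Evaluation

open PowerSeries

/-- The power series `p` converges at `z` to `c`. -/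
def HasEval (z : ℂ) (p : PowerSeries ℂ) (c : ℂ) : Prop :=
  HasSum (fun n => coeff n p * z ^ n) c

variable {z : ℂ} {p q : PowerSeries ℂ} {a b : ℂ}

lemma HasEval.unique (h : HasEval z p a) (h' : HasEval z p b) : a = b := HasSum.unique h h'

lemma HasEval.add (hp : HasEval z p a) (hq : HasEval z q b) : HasEval z (p + q) (a + b) := by
  have := HasSum.add hp hq
  simpa only [HasEval, map_add, add_mul] using this

lemma HasEval.neg (hp : HasEval z p a) : HasEval z (-p) (-a) := by
  have := HasSum.neg hp
  simpa only [HasEval, map_neg, neg_mul] using this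

lemma HasEval.sub (hp : HasEval z p a) (hq : HasEval z q b) : HasEval z (p - q) (a - b) := by
  rw [sub_eq_add_neg, sub_eq_add_neg]
  exact hp.add hq.neg

lemma HasEval.mul (hp : HasEval z p a) (hq : HasEval z q b) : HasEval z (p * q) (a * b) := by
  have h1 : ∀ n, coeff n (p * q) * z ^ n = ∑ c ∈ Finset.HasAntidiagonal.antidiagonal n,
      (coeff c.1 p * z ^ c.1) * (coeff c.2 q * z ^ c.2) := fun n => by
    rw [coeff_mul, Finset.sum_mul]
    refine Finset.sum_congr rfl fun c hc => ?_
    rw [← Finset.HasAntidiagonal.mem_antidiagonal.mp hc, pow_add]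
    ring
  have hp' := summable_norm_iff.mpr hp.summable
  have hq' := summable_norm_iff.mpr hq.summable
  rw [HasEval, funext h1, ← hp.tsum_eq, ← hq.tsum_eq,
    tsum_mul_tsum_eq_tsum_sum_antidiagonal_of_summable_norm hp' hq']
  exact (summable_norm_sum_mul_antidiagonal_of_summable_norm hp' hq').of_norm.hasSum

lemma hasEval_C (z c : ℂ) : HasEval z (C c) c := by
  have := hasSum_single (f := fun n => coeff n (C c) * z ^ n) 0 (fun n hn => by
    rw [coeff_C, if_neg hn, zero_mul])
  simpa [HasEval] using this

lemma hasEval_zero (z : ℂ) : HasEval z 0 0 := by simpa using hasEval_C z 0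

lemma hasEval_one (z : ℂ) : HasEval z 1 1 := by simpa using hasEval_C z 1

lemma hasEval_X (z : ℂ) : HasEval z X z := by
  have := hasSum_single (f := fun n => coeff n (X : PowerSeries ℂ) * z ^ n) 1 (fun n hn => by
    rw [coeff_X, if_neg hn, zero_mul])
  simpa [HasEval, coeff_X] using this

lemma HasEval.pow (hp : HasEval z p a) (n : ℕ) : HasEval z (p ^ n) (a ^ n) := by
  induction n with
  | zero => simpa using hasEval_one z
  | succ n ih => rw [pow_succ, pow_succ]; exact ih.mul hp

lemma hasEval_sum {ι : Type*} (s : Finset ι) {f : ι → PowerSeries ℂ} {g : ι → ℂ}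
    (h : ∀ i ∈ s, HasEval z (f i) (g i)) : HasEval z (∑ i ∈ s, f i) (∑ i ∈ s, g i) := by
  classical
  induction s using Finset.induction_on with
  | empty => simpa using hasEval_zero z
  | insert i s hi ih =>
    rw [Finset.sum_insert hi, Finset.sum_insert hi]
    exact (h i (Finset.mem_insert_self i s)).add
      (ih fun j hj => h j (Finset.mem_insert_of_mem hj))

lemma hasEval_prod {ι : Type*} (s : Finset ι) {f : ι → PowerSeries ℂ} {g : ι → ℂ}
    (h : ∀ i ∈ s, HasEval z (f i) (g i)) : HasEval z (∏ i ∈ s, f i) (∏ i ∈ s, g i) := by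
  classical
  induction s using Finset.induction_on with
  | empty => simpa using hasEval_one z
  | insert i s hi ih =>
    rw [Finset.prod_insert hi, Finset.prod_insert hi]
    exact (h i (Finset.mem_insert_self i s)).mul
      (ih fun j hj => h j (Finset.mem_insert_of_mem hj))

lemma hasEval_exp (z c : ℂ) : HasEval z (rescale c (exp ℂ)) (Complex.exp (c * z)) := by
  have h := NormedSpace.expSeries_div_hasSum_exp (c * z)
  rw [← Complex.exp_eq_exp_ℂ] at h
  refine (congrArg (fun F => HasSum F _ _) (funext fun n => ?_)).mpr h
  rw [coeff_rescale, coeff_exp, mul_pow]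
  simp
  ring

lemma hasFPowerSeriesAt_of_summable (hz : z ≠ 0) (h : Summable fun n => coeff n p * z ^ n) :
    HasFPowerSeriesAt (FormalMultilinearSeries.ofScalars ℂ (fun n => coeff n p)).sum
      (FormalMultilinearSeries.ofScalars ℂ (fun n => coeff n p)) 0 := by
  refine (FormalMultilinearSeries.hasFPowerSeriesOnBall _ ?_).hasFPowerSeriesAt
  refine lt_of_lt_of_le ?_ (FormalMultilinearSeries.le_radius_of_summable_norm (r := ‖z‖₊) _ ?_)
  · simpa using hz
  · simpa [FormalMultilinearSeries.ofScalars_norm] using summable_norm_iff.mpr h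

lemma eventually_summable (hz : z ≠ 0) (h : Summable fun n => coeff n p * z ^ n) :
    ∀ᶠ w in 𝓝 (0 : ℂ), HasEval w p
      ((FormalMultilinearSeries.ofScalars ℂ (fun n => coeff n p)).sum w) := by
  filter_upwards [hasFPowerSeriesAt_iff.mp (hasFPowerSeriesAt_of_summable hz h)] with w hw
  simpa [FormalMultilinearSeries.coeff_ofScalars, mul_comm, HasEval] using hw

lemma frequently_left : ∃ᶠ _ in 𝓝[{z : ℂ | z.re < 0}] (0 : ℂ), True := by
  rw [Filter.frequently_true_iff_neBot, ← mem_closure_iff_nhdsWithin_neBot,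
    Complex.closure_setOfPred_re_lt]
  simp

/-- A power series that vanishes near `0` in the left half plane is zero. -/
lemma eq_zero_of_hasEval (h : ∀ᶠ w in 𝓝[{z : ℂ | z.re < 0}] (0 : ℂ), HasEval w p 0) : p = 0 := by
  have hleft : ∀ᶠ w in 𝓝[{z : ℂ | z.re < 0}] (0 : ℂ), w ≠ 0 := by
    filter_upwards [self_mem_nhdsWithin] with w hw h0
    simp [h0] at hw
  obtain ⟨w₀, -, hw₀, hne⟩ := (frequently_left.and_eventually (h.and hleft)).exists
  have hA := hasFPowerSeriesAt_of_summable hne hw₀.summable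
  have hE := eventually_summable hne hw₀.summable
  have hfreq : ∃ᶠ w in 𝓝[≠] (0 : ℂ),
      (FormalMultilinearSeries.ofScalars ℂ (fun n => coeff n p)).sum w = 0 := by
    have h1 : ∃ᶠ w in 𝓝[{z : ℂ | z.re < 0}] (0 : ℂ),
        (FormalMultilinearSeries.ofScalars ℂ (fun n => coeff n p)).sum w = 0 :=
      (frequently_left.and_eventually (h.and (nhdsWithin_le_nhds hE))).mono
        fun w hw => hw.2.2.unique hw.2.1
    refine h1.filter_mono (nhdsWithin_mono 0 fun w hw h0 => ?_)
    simp [Set.mem_singleton_iff.mp h0] at hw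
  -- Zeros in the left half plane accumulate at `0`, so the analytic function vanishes on a full
  -- neighbourhood.
  have h0 := hA.analyticAt.frequently_zero_iff_eventually_zero.mp hfreq
  have h2 := hA.eq_zero_of_eventually h0
  rw [FormalMultilinearSeries.ofScalars_series_eq_zero] at h2
  ext n
  exact congrFun h2 n

/-- The inverse of a convergent power series converges. -/
lemma exists_mul_eq_one (hp : ∀ w, Summable fun n => coeff n p * w ^ n)
    (h0 : constantCoeff p ≠ 0) :
    ∃ r : PowerSeries ℂ, r * p = 1 ∧ ∀ᶠ w in 𝓝 (0 : ℂ), ∃ c, HasEval w r c := by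
  set f := (FormalMultilinearSeries.ofScalars ℂ (fun n => coeff n p)).sum
  have hA := hasFPowerSeriesAt_of_summable one_ne_zero (hp 1)
  have hE : ∀ᶠ w in 𝓝 (0 : ℂ), HasEval w p (f w) := eventually_summable one_ne_zero (hp 1)
  have hf0 : f 0 = constantCoeff p := by
    refine hE.self_of_nhds.unique ?_
    have := hasSum_single (f := fun n => coeff n p * (0 : ℂ) ^ n) 0 (fun n hn => by simp [hn])
    simpa [HasEval] using this
  have hf0' : f 0 ≠ 0 := by rwa [hf0]
  obtain ⟨s, hs⟩ := hA.analyticAt.inv hf0'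
  have hr : ∀ᶠ w in 𝓝 (0 : ℂ), HasEval w (mk fun n => s.coeff n) (f w)⁻¹ := by
    filter_upwards [hasFPowerSeriesAt_iff.mp hs] with w hw
    simpa [HasEval, mul_comm] using hw
  refine ⟨mk fun n => s.coeff n, ?_, hr.mono fun w hw => ⟨_, hw⟩⟩
  have hne : ∀ᶠ w in 𝓝 (0 : ℂ), f w ≠ 0 := hA.continuousAt.eventually_ne hf0'
  refine sub_eq_zero.mp (eq_zero_of_hasEval (nhdsWithin_le_nhds ?_))
  filter_upwards [hr, hE, hne] with w h1 h2 h3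
  simpa [inv_mul_cancel₀ h3] using (h1.mul h2).sub (hasEval_one w)

/-- The series `V = (1 - e^{cz})/z` is a unit with convergent inverse, so `geomSeries c = V⁻¹
e^{cz}` converges near `0`. Its value follows from `geomSeries_mul` wherever `e^{cw} ≠ 1`. -/
lemma eventually_hasEval_geomSeries {c : ℚ} (hc : c ≠ 0) :
    ∀ᶠ w in 𝓝 (0 : ℂ), Complex.exp (c * w) ≠ 1 →
      HasEval w (PowerSeries.map (algebraMap ℚ ℂ) (geomSeries c))
        (w * Complex.exp (c * w) / (1 - Complex.exp (c * w))) := by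
  have hexp : PowerSeries.map (algebraMap ℚ ℂ) (rescale c (exp ℚ)) = rescale (c : ℂ) (exp ℂ) := by
    ext n
    simp [coeff_rescale]
  have h1 := congrArg (PowerSeries.map (algebraMap ℚ ℂ)) (geomSeries_mul hc)
  rw [map_mul, map_mul, map_sub, map_one, map_X, hexp] at h1
  have h2 := eq_X_mul_shift_add_const (1 - rescale (c : ℂ) (exp ℂ))
  set V : PowerSeries ℂ := mk fun n => coeff (n + 1) (1 - rescale (c : ℂ) (exp ℂ)) with hV
  have h3 : constantCoeff (1 - rescale (c : ℂ) (exp ℂ)) = 0 := by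
    rw [map_sub, ← coeff_zero_eq_constantCoeff_apply, ← coeff_zero_eq_constantCoeff_apply,
      coeff_rescale]
    simp
  rw [h3, map_zero, add_zero] at h2
  have hsum : ∀ w, Summable fun n => coeff n V * w ^ n := by
    intro w
    by_cases hw : w = 0
    · refine summable_of_ne_finset_zero (s := {0}) fun n hn => ?_
      rw [hw, zero_pow (by simpa using hn), mul_zero]
    · have h4 := ((hasEval_one w).sub (hasEval_exp w c)).summable
      rw [← summable_nat_add_iff 1] at h4
      refine (h4.mul_right w⁻¹).congr fun n => ?_
      rw [hV, coeff_mk, pow_succ]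
      field_simp
  obtain ⟨r, hr1, hr2⟩ := exists_mul_eq_one hsum (by
    rw [← coeff_zero_eq_constantCoeff_apply, hV, coeff_mk, map_sub, coeff_rescale]
    simpa [coeff_one] using hc)
  have h5 : PowerSeries.map (algebraMap ℚ ℂ) (geomSeries c) = r * rescale (c : ℂ) (exp ℂ) := by
    have h6 : PowerSeries.map (algebraMap ℚ ℂ) (geomSeries c) * V = rescale (c : ℂ) (exp ℂ) := by
      refine mul_left_cancel₀ X_ne_zero ?_
      rw [← h1]
      linear_combination (-PowerSeries.map (algebraMap ℚ ℂ) (geomSeries c)) * h2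
    rw [← h6]
    linear_combination (-PowerSeries.map (algebraMap ℚ ℂ) (geomSeries c)) * hr1
  filter_upwards [hr2] with w ⟨d, hd⟩ hne
  have h6 := hd.mul (hasEval_exp w c)
  rw [← h5] at h6
  have h7 := h6.mul ((hasEval_one w).sub (hasEval_exp w c))
  rw [h1] at h7
  have h8 := h7.unique ((hasEval_X w).mul (hasEval_exp w c))
  rwa [← h8, mul_div_cancel_right₀ _ (sub_ne_zero.mpr hne.symm)]

end Evaluation

/-! ### The regularized sums for `Re z < 0`. -/

section RegularizedValue

variable {q : ℂ}

/-- The product `∏_{s=1}^r q^s / (1 - q^s)`. -/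
noncomputable def zerosValue (q : ℂ) (r : ℕ) : ℂ :=
  ∏ s ∈ Finset.range r, q ^ (s + 1) / (1 - q ^ (s + 1))

lemma zerosValue_zero (q : ℂ) : zerosValue q 0 = 1 := by simp [zerosValue]

lemma zerosValue_succ (q : ℂ) (r : ℕ) :
    zerosValue q (r + 1) = zerosValue q r * (q ^ (r + 1) / (1 - q ^ (r + 1))) := by
  rw [zerosValue, zerosValue, Finset.prod_range_succ]

lemma one_sub_pow_ne_zero (hq : ‖q‖ < 1) (r : ℕ) : 1 - q ^ (r + 1) ≠ 0 := by
  intro h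
  have h1 : ‖q ^ (r + 1)‖ < 1 := by
    rw [norm_pow]
    exact pow_lt_one₀ (norm_nonneg q) hq (by omega)
  rw [← sub_eq_zero.mp h, norm_one] at h1
  exact lt_irrefl _ h1

lemma pow_mul_zerosValue (hq : ‖q‖ < 1) (n r : ℕ) :
    q ^ (n * (r + 1)) * zerosValue q (r + 1) =
      q ^ ((n + 1) * (r + 1)) * zerosValue q (r + 1) +
        q ^ (n + 1) * (q ^ ((n + 1) * r) * zerosValue q r) := by
  have h := one_sub_pow_ne_zero hq r
  rw [zerosValue_succ]
  field_simp
  ring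

/-- The values `q^{nr} zerosValue q r` are `e_r(q^{n+1}, q^{n+2}, …)`. Sorting by the smallest index
leaves a geometric series of ratio `q^{r+1}`. -/
lemma hasSum_pow_mul_zerosValue (hq : ‖q‖ < 1) (n r : ℕ) :
    HasSum (fun i => if n ≤ i then q ^ (i + 1) * (q ^ ((i + 1) * r) * zerosValue q r) else 0)
      (q ^ (n * (r + 1)) * zerosValue q (r + 1)) := by
  have hq' : ‖q ^ (r + 1)‖ < 1 := by
    rw [norm_pow]
    exact pow_lt_one₀ (norm_nonneg q) hq (by omega)
  have h := (hasSum_geometric_of_norm_lt_one hq').mul_left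
    (q ^ ((n + 1) * (r + 1)) * zerosValue q r)
  rw [← hasSum_nat_add_iff' n]
  have h0 : ∑ i ∈ Finset.range n,
      (if n ≤ i then q ^ (i + 1) * (q ^ ((i + 1) * r) * zerosValue q r) else 0) = 0 :=
    Finset.sum_eq_zero fun i hi => by rw [if_neg (by have := Finset.mem_range.mp hi; omega)]
  rw [h0, sub_zero]
  have h1 : q ^ (n * (r + 1)) * zerosValue q (r + 1) =
      q ^ ((n + 1) * (r + 1)) * zerosValue q r * (1 - q ^ (r + 1))⁻¹ := by
    rw [zerosValue_succ]
    ring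
  rw [h1]
  refine (congrArg (fun F => HasSum F _ _) (funext fun i => ?_)).mpr h
  rw [if_pos (by omega), ← pow_mul]
  ring

lemma summable_prod_pow (hq : ‖q‖ < 1) (n : ℕ) :
    Summable fun f : Fin n → ℕ => ∏ j, q ^ (f j + 1) := by
  induction n with
  | zero => exact Summable.of_finite
  | succ n ih =>
    have h1 : Summable fun i : ℕ => q ^ (i + 1) := by
      simpa [pow_succ] using (summable_geometric_of_norm_lt_one hq).mul_right q
    have h2 := (h1.norm.mul_norm ih.norm).of_norm
    rw [← (Fin.consEquiv fun _ : Fin (n + 1) => ℕ).summable_iff]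
    refine h2.congr fun p => ?_
    simp [Fin.consEquiv, Fin.prod_univ_succ]

lemma summable_indexSeqAbove (hq : ‖q‖ < 1) (n₀ : ℕ) {n : ℕ} (v : Fin n → ℕ) (m : ℕ+ →₀ ℕ) :
    Summable fun s : IndexSeqAbove n₀ v m => ∏ j, q ^ ((s.1 j).natPred + 1) := by
  have hinj : Function.Injective
      (fun (s : IndexSeqAbove n₀ v m) (j : Fin n) => (s.1 j).natPred) := fun s t h =>
    Subtype.ext (DFunLike.ext s.1 t.1 fun j => PNat.natPred_injective (congrFun h j))
  have h := Summable.comp_injective (f := fun f : Fin n → ℕ => ∏ j, q ^ (f j + 1))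
    (summable_prod_pow hq n) hinj
  exact h

lemma norm_exp_lt_one (δ : ℕ+) {z : ℂ} (hz : z.re < 0) : ‖Complex.exp ((δ : ℕ) * z)‖ < 1 := by
  rw [Complex.norm_exp, Real.exp_lt_one_iff]
  have : (0 : ℝ) < (δ : ℕ) := by exact_mod_cast δ.pos
  simpa using mul_neg_of_pos_of_neg this hz

/-- The coefficients of the regularized sum in a constant direction. -/
lemma regularizedCoeff_constWord (δ : ℕ+) (α : List ℕ) (m : ℕ+ →₀ ℕ) (t : ℝ) {z : ℂ}
    (hz : z.re < 0) :
    regularizedCoeff (constWord δ α) m t z =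
      Complex.exp (t * (δ : ℕ) * z) ^ α.length *
        iterCoeff (fun i => Complex.exp ((δ : ℕ) * z) ^ (i + 1))
          (fun n r => Complex.exp ((δ : ℕ) * z) ^ (n * r) *
            zerosValue (Complex.exp ((δ : ℕ) * z)) r) 0 α m := by
  set q := Complex.exp ((δ : ℕ) * z) with hqdef
  have hq : ‖q‖ < 1 := norm_exp_lt_one δ hz
  have h := hasSum_iterCoeff (τ := ℕ × ℕ+) Prod.fst (fun _ => True) (fun _ _ _ => trivial)
    (ε := fun i => q ^ (i + 1)) (χ := fun n r => q ^ (n * r) * zerosValue q r)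
    (fun n => by simp [zerosValue_zero]) (fun r n _ => hasSum_pow_mul_zerosValue hq n r)
    (fun W n m _ => summable_indexSeqAbove hq n _ m) (constWord δ α) 0 m trivial
  have hmap : (constWord δ α).map Prod.fst = α := by simp [constWord, Function.comp_def]
  rw [hmap] at h
  rw [← (h.mul_left _).tsum_eq, regularizedCoeff,
    ← (indexSeqEquiv (fun j => ((constWord δ α).get j).1) m).tsum_eq]
  refine tsum_congr fun s => ?_
  have hlen : (constWord δ α).length = α.length := by simp [constWord]
  have hc : Complex.exp (t * (δ : ℕ) * z) ^ α.length =
      ∏ _j : Fin (constWord δ α).length, Complex.exp (t * (δ : ℕ) * z) := by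
    rw [Finset.prod_const, Finset.card_univ, Fintype.card_fin, hlen]
  rw [hc, ← Finset.prod_mul_distrib]
  refine Finset.prod_congr rfl fun j _ => ?_
  have hδ : ((constWord δ α).get j).2 = δ := by simp [constWord]
  rw [hδ, hqdef, ← Complex.exp_nat_mul, ← Complex.exp_add]
  congr 1
  have : (((s.1 j : ℕ+) : ℕ) : ℂ) = ((s.1 j).natPred + 1 : ℕ) := by rw [PNat.natPred_add_one]
  change ((((s.1 j : ℕ+) : ℕ) : ℂ) + t) * (δ : ℕ) * z = t * (δ : ℕ) * z +
    (((s.1 j).natPred + 1 : ℕ) : ℂ) * ((δ : ℕ) * z)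
  rw [this]
  ring

end RegularizedValue

/-! ### Expansion at `z = 0` of each coefficient. -/

section RegularizationFormula

open PowerSeries

/-- The power series `e^{(i+1)dz}`. -/
noncomputable def indexExp (d : ℚ) (i : ℕ) : PowerSeries ℚ := rescale ((i + 1) * d) (exp ℚ)

/-- The coefficient of `x^m` in the regularized sum at `t = 0`, multiplied by a power of `z`. -/
noncomputable def coeffSeries (d : ℚ) (m : ℕ+ →₀ ℕ) (α : List ℕ) : PowerSeries ℚ :=
  conv (fun v => X ^ v.length * iterCoeff (indexExp d) (invSum (indexExp d)) 0 v m)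
    (onZeros (zerosSeries d)) α

lemma HasEval.iterCoeff {z : ℂ} {ε : ℕ → PowerSeries ℂ} {ε' : ℕ → ℂ}
    {S : ℕ → ℕ → PowerSeries ℂ} {S' : ℕ → ℕ → ℂ} (hε : ∀ i, HasEval z (ε i) (ε' i))
    (hS : ∀ n r, HasEval z (S n r) (S' n r)) (n : ℕ) (w : List ℕ) (m : ℕ+ →₀ ℕ) :
    HasEval z (iterCoeff ε S n w m) (iterCoeff ε' S' n w m) := by
  induction w generalizing n m with
  | nil =>
    unfold RenormalizedQSym.iterCoeff
    split_ifs
    · exact hasEval_one z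
    · exact hasEval_zero z
  | cons a w ih =>
    unfold RenormalizedQSym.iterCoeff onZeros
    split_ifs
    · exact hS _ _
    · exact hasEval_zero z
    · refine hasEval_sum _ fun i _ => ?_
      split_ifs
      · exact (hε i).mul (ih _ _)
      · exact hasEval_zero z

lemma HasEval.invSum {z : ℂ} {ε : ℕ → PowerSeries ℂ} {ε' : ℕ → ℂ}
    (hε : ∀ i, HasEval z (ε i) (ε' i)) (n r : ℕ) : HasEval z (invSum ε n r) (invSum ε' n r) := by
  induction n generalizing r with
  | zero =>
    cases r with
    | zero => simpa only [RenormalizedQSym.invSum] using hasEval_one z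
    | succ r => simpa only [RenormalizedQSym.invSum] using hasEval_zero z
  | succ n ih =>
    induction r with
    | zero => simpa only [RenormalizedQSym.invSum] using hasEval_one z
    | succ r ihr => simpa only [RenormalizedQSym.invSum] using (ih _).sub ((hε n).mul ihr)

lemma hasEval_map_exp (z : ℂ) (c : ℚ) :
    HasEval z (PowerSeries.map (algebraMap ℚ ℂ) (rescale c (exp ℚ))) (Complex.exp (c * z)) := by
  have hexp : PowerSeries.map (algebraMap ℚ ℂ) (rescale c (exp ℚ)) = rescale (c : ℂ) (exp ℂ) := by
    ext n
    simp [coeff_rescale]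
  rw [hexp]
  exact hasEval_exp z c

/-- The coefficient series converges to the regularized sum. -/
lemma eventually_hasEval_coeffSeries (δ : ℕ+) (m : ℕ+ →₀ ℕ) (α : List ℕ) :
    ∀ᶠ z in 𝓝[{z : ℂ | z.re < 0}] (0 : ℂ),
      HasEval z (PowerSeries.map (algebraMap ℚ ℂ) (coeffSeries (δ : ℕ) m α))
        (z ^ α.length * iterCoeff (fun i => Complex.exp ((δ : ℕ) * z) ^ (i + 1))
          (fun n r => Complex.exp ((δ : ℕ) * z) ^ (n * r) *
            zerosValue (Complex.exp ((δ : ℕ) * z)) r) 0 α m) := by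
  have hgeom : ∀ᶠ z in 𝓝 (0 : ℂ), ∀ s ∈ Finset.range α.length,
      Complex.exp ((((s + 1) * (δ : ℕ) : ℚ) : ℂ) * z) ≠ 1 →
      HasEval z (PowerSeries.map (algebraMap ℚ ℂ) (geomSeries ((s + 1) * (δ : ℕ))))
        (z * Complex.exp ((((s + 1) * (δ : ℕ) : ℚ) : ℂ) * z) /
          (1 - Complex.exp ((((s + 1) * (δ : ℕ) : ℚ) : ℂ) * z))) := by
    rw [Filter.eventually_all_finset]
    intro s _
    refine eventually_hasEval_geomSeries ?_
    have : (0 : ℚ) < (δ : ℕ) := by exact_mod_cast δ.pos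
    positivity
  filter_upwards [nhdsWithin_le_nhds hgeom, self_mem_nhdsWithin] with z hz hre
  set q := Complex.exp ((δ : ℕ) * z) with hqdef
  have hq : ‖q‖ < 1 := norm_exp_lt_one δ hre
  have hqs : ∀ s : ℕ, Complex.exp ((((s + 1) * (δ : ℕ) : ℚ) : ℂ) * z) = q ^ (s + 1) := fun s => by
    rw [hqdef, ← Complex.exp_nat_mul]
    congr 1
    push_cast
    ring
  have hε : ∀ i, HasEval z (PowerSeries.map (algebraMap ℚ ℂ) (indexExp (δ : ℕ) i)) (q ^ (i + 1)) :=
    fun i => by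
      rw [← hqs]
      exact hasEval_map_exp z _
  have hzeros : ∀ r, r ≤ α.length →
      HasEval z (PowerSeries.map (algebraMap ℚ ℂ) (zerosSeries (δ : ℕ) r))
        (z ^ r * zerosValue q r) := fun r hr => by
    have h1 : z ^ r * zerosValue q r =
        ∏ s ∈ Finset.range r, z * q ^ (s + 1) / (1 - q ^ (s + 1)) := by
      rw [zerosValue, ← Finset.card_range r, ← Finset.prod_const, Finset.card_range,
        ← Finset.prod_mul_distrib]
      exact Finset.prod_congr rfl fun s _ => (mul_div_assoc _ _ _).symm
    rw [h1, zerosSeries, map_prod]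
    refine hasEval_prod _ fun s hs => ?_
    have h2 := hz s (Finset.mem_range.mpr ((Finset.mem_range.mp hs).trans_le hr))
    rw [hqs] at h2
    exact h2 fun h => one_sub_pow_ne_zero hq s (sub_eq_zero.mpr h.symm)
  -- The factorization `φ = Q ⋆ Z` at the level of values: only `zerosValue` has denominators, and
  -- they are cleared by powers of `z`.
  have hconv : iterCoeff (fun i => q ^ (i + 1)) (fun n r => q ^ (n * r) * zerosValue q r) 0 α m =
      conv (fun v => iterCoeff (fun i => q ^ (i + 1)) (invSum fun i => q ^ (i + 1)) 0 v m)
        (onZeros (zerosValue q)) α := by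
    refine iterCoeff_eq_conv invSum_zero_right (zerosValue_zero q) (fun n r => ?_) 0 α m
    have := eq_invSum_mul (ε := fun i => q ^ (i + 1))
      (χ := fun n r => q ^ (n * r) * zerosValue q r) (fun n => by simp [zerosValue_zero])
      (fun n r => pow_mul_zerosValue hq n r) n r
    simpa using this
  rw [hconv, ← conv_pow_length, coeffSeries, map_conv, conv_eq_sum_range, conv_eq_sum_range]
  refine hasEval_sum _ fun i hi => HasEval.mul ?_ ?_
  · rw [map_mul, map_pow, map_X, map_iterCoeff]
    refine ((hasEval_X z).pow _).mul (HasEval.iterCoeff hε (fun n r => ?_) 0 _ m)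
    rw [map_invSum]
    exact HasEval.invSum hε n r
  · unfold onZeros
    split_ifs
    · exact hzeros _ (by simp)
    · rw [map_zero, mul_zero]
      exact hasEval_zero z

end RegularizationFormula

/-! ### Uniqueness of the Laurent expansion. -/

section Uniqueness

/-- Laurent series and power series. -/
lemma hasSum_int_iff {f : ℤ → ℂ} {N : ℕ} (hf : ∀ n : ℤ, n < -N → f n = 0) {z : ℂ} (hz : z ≠ 0)
    (c : ℂ) : HasSum (fun n : ℤ => f n * z ^ n) c ↔
      HasEval z (PowerSeries.mk fun j => f (j - N)) (z ^ N * c) := by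
  have hinj : Function.Injective fun j : ℕ => (j : ℤ) - N := fun i j h => by
    simpa using h
  rw [← hinj.hasSum_iff (fun n hn => by
    rw [hf n, zero_mul]
    by_contra h
    exact hn ⟨(n + N).toNat, by simp; omega⟩)]
  rw [HasEval, ← hasSum_mul_left_iff (pow_ne_zero N hz)]
  refine iff_of_eq (congrArg (fun F => HasSum F _ _) (funext fun j => ?_))
  rw [PowerSeries.coeff_mk, Function.comp_apply, zpow_sub₀ hz, zpow_natCast, zpow_natCast]
  field_simp

/-- The value at `t` of the coefficient of `x^m`. -/
noncomputable def evalAt (m : ℕ+ →₀ ℕ) (t : ℝ) : Polynomial (MvPowerSeries ℕ+ ℚ) →+ ℂ where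
  toFun f := f.sum fun s g => ((MvPowerSeries.coeff m g : ℚ) : ℂ) * (t : ℂ) ^ s
  map_zero' := Polynomial.sum_zero_index _
  map_add' f g := Polynomial.sum_add_index f g _ (fun s => by simp) (fun s a b => by
    rw [map_add]; push_cast; ring)

lemma evalAt_monomial (m : ℕ+ →₀ ℕ) (t : ℝ) (s : ℕ) (g : MvPowerSeries ℕ+ ℚ) :
    evalAt m t (Polynomial.monomial s g) =
      ((MvPowerSeries.coeff m g : ℚ) : ℂ) * (t : ℂ) ^ s := by
  change (Polynomial.monomial s g).sum
    (fun s g => ((MvPowerSeries.coeff m g : ℚ) : ℂ) * (t : ℂ) ^ s) = _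
  exact Polynomial.sum_monomial_index _ _ (by simp)

lemma isRegularization_iff (w : DirectedWord) (F : Target) :
    IsRegularization w F ↔ ∀ (m : ℕ+ →₀ ℕ) (t : ℝ), 0 ≤ t →
      ∀ᶠ z : ℂ in 𝓝[{z : ℂ | z.re < 0}] 0,
        HasSum (fun n : ℤ => evalAt m t (F.coeff n) * z ^ n) (regularizedCoeff w m t z) := Iff.rfl

/-- For each `m` the coefficients of `x^m` form a polynomial in `t` with infinitely many zeros. -/
lemma eq_zero_of_evalAt {f : Polynomial (MvPowerSeries ℕ+ ℚ)}
    (h : ∀ m t, 0 ≤ t → evalAt m t f = 0) : f = 0 := by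
  ext s m
  let P : Polynomial ℂ := f.sum fun s g =>
    Polynomial.monomial s ((MvPowerSeries.coeff m g : ℚ) : ℂ)
  have hP : P = 0 := by
    refine Polynomial.eq_of_infinite_eval_eq P 0 ?_
    have hinf : ((fun t : ℝ => (t : ℂ)) '' Set.Ici 0).Infinite :=
      (Set.Ici_infinite 0).image Complex.ofReal_injective.injOn
    refine hinf.mono ?_
    rintro _ ⟨t, ht, rfl⟩
    have := h m t ht
    simpa [P, Polynomial.sum_def, Polynomial.eval_finsetSum, evalAt] using this
  have h2 : P.coeff s = ((MvPowerSeries.coeff m (f.coeff s) : ℚ) : ℂ) := by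
    simp only [P, Polynomial.sum_def, Polynomial.finsetSum_coeff, Polynomial.coeff_monomial]
    rw [Finset.sum_ite_eq' f.support s]
    split_ifs with hs
    · rfl
    · rw [Polynomial.notMem_support_iff.mp hs]; simp
  rw [hP, Polynomial.coeff_zero] at h2
  simpa using h2.symm

lemma exists_coeff_eq_zero (F : Target) : ∃ N : ℕ, ∀ n : ℤ, n < -N → F.coeff n = 0 :=
  ⟨F.order.natAbs, fun n hn => HahnSeries.coeff_eq_zero_of_lt_order (by omega)⟩

lemma IsRegularization.unique {w : DirectedWord} {F G : Target} (hF : IsRegularization w F)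
    (hG : IsRegularization w G) : F = G := by
  rw [isRegularization_iff] at hF hG
  obtain ⟨N, hN⟩ := exists_coeff_eq_zero (F - G)
  refine sub_eq_zero.mp (HahnSeries.ext (funext fun n => ?_))
  refine eq_zero_of_evalAt fun m t ht => ?_
  have hp : (PowerSeries.mk fun j : ℕ => evalAt m t ((F - G).coeff (j - N))) = 0 := by
    refine eq_zero_of_hasEval ?_
    filter_upwards [hF m t ht, hG m t ht, self_mem_nhdsWithin] with z h1 h2 hz
    have hz0 : z ≠ 0 := fun h => by simp [h] at hz
    have h3 := h1.sub h2
    rw [sub_self] at h3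
    have h4 := (hasSum_int_iff (f := fun n => evalAt m t ((F - G).coeff n)) (N := N)
      (fun n hn => by rw [hN n hn, map_zero]) hz0 0).mp
      ((congrArg (fun F => HasSum F _ _) (funext fun n => by
        rw [HahnSeries.coeff_sub, map_sub, sub_mul])).mpr h3)
    rwa [mul_zero] at h4
  by_cases hn : n < -N
  · rw [hN n hn, map_zero]
  · have h5 := congrArg (PowerSeries.coeff (n + N).toNat) hp
    rw [PowerSeries.coeff_mk, map_zero, Int.toNat_of_nonneg (by omega), add_sub_cancel_right] at h5
    exact h5

lemma regularization_eq {w : DirectedWord} {F : Target} (hF : IsRegularization w F) :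
    regularization w = F := by
  have h : ∃ F, IsRegularization w F := ⟨F, hF⟩
  rw [regularization, dif_pos h]
  exact h.choose_spec.unique hF

end Uniqueness

/-! ### The regularization as a Laurent series, and its renormalized value. -/

section Existence

open PowerSeries

/-- The coefficients in `z` of the regular factor of the regularized sum at `t = 0`. -/
noncomputable def regularSeriesCoeff (d : ℚ) (v : List ℕ) (e : ℕ) : MvPowerSeries ℕ+ ℚ :=
  fun m => coeff e (iterCoeff (indexExp d) (invSum (indexExp d)) 0 v m)

/-- The regular factor of the regularized sum at `t = 0`. -/
noncomputable def regularSeries (d : ℚ) (v : List ℕ) : PowerSeries (MvPowerSeries ℕ+ ℚ) :=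
  mk (regularSeriesCoeff d v)

lemma coeff_regularSeries (d : ℚ) (v : List ℕ) (e : ℕ) (m : ℕ+ →₀ ℕ) :
    MvPowerSeries.coeff m (coeff e (regularSeries d v)) =
      coeff e (iterCoeff (indexExp d) (invSum (indexExp d)) 0 v m) := by
  rw [regularSeries, coeff_mk]
  rfl

/-- The coefficient of `x^m` in a power series in `z`. -/
noncomputable def coeffwise (m : ℕ+ →₀ ℕ) :
    PowerSeries (MvPowerSeries ℕ+ ℚ) →+ PowerSeries ℚ where
  toFun F := mk fun e => MvPowerSeries.coeff m (coeff e F)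
  map_zero' := by ext; simp
  map_add' F G := by ext; simp

lemma coeff_coeffwise (m : ℕ+ →₀ ℕ) (F : PowerSeries (MvPowerSeries ℕ+ ℚ)) (e : ℕ) :
    coeff e (coeffwise m F) = MvPowerSeries.coeff m (coeff e F) := by
  change coeff e (mk fun e => MvPowerSeries.coeff m (coeff e F)) = _
  exact coeff_mk _ _

lemma coeffwise_mul_map (m : ℕ+ →₀ ℕ) (F : PowerSeries (MvPowerSeries ℕ+ ℚ))
    (g : PowerSeries ℚ) :
    coeffwise m (F * PowerSeries.map (algebraMap ℚ _) g) = coeffwise m F * g := by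
  ext e
  rw [coeff_coeffwise, coeff_mul, coeff_mul, map_sum]
  refine Finset.sum_congr rfl fun c _ => ?_
  rw [coeff_map, coeff_coeffwise, MvPowerSeries.algebraMap_apply, MvPowerSeries.coeff_mul_C]
  rfl

/-- The regularized sum at `t = 0`, multiplied by a power of `z`. -/
noncomputable def totalSeries (d : ℚ) (α : List ℕ) : PowerSeries (MvPowerSeries ℕ+ ℚ) :=
  conv (fun v => X ^ v.length * regularSeries d v)
    (onZeros fun r => PowerSeries.map (algebraMap ℚ _) (zerosSeries d r)) α

lemma coeffwise_totalSeries (d : ℚ) (m : ℕ+ →₀ ℕ) (α : List ℕ) :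
    coeffwise m (totalSeries d α) = coeffSeries d m α := by
  rw [totalSeries, coeffSeries, conv_eq_sum_range, conv_eq_sum_range, map_sum]
  refine Finset.sum_congr rfl fun i _ => ?_
  have h1 : onZeros (fun r => PowerSeries.map (algebraMap ℚ (MvPowerSeries ℕ+ ℚ))
      (zerosSeries d r)) (α.drop i) =
      PowerSeries.map (algebraMap ℚ _) (onZeros (zerosSeries d) (α.drop i)) := by
    unfold onZeros
    split_ifs <;> simp
  have h2 : (X : PowerSeries (MvPowerSeries ℕ+ ℚ)) ^ (α.take i).length =
      PowerSeries.map (algebraMap ℚ _) (X ^ (α.take i).length) := by simp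
  have h3 : coeffwise m (regularSeries d (α.take i)) =
      iterCoeff (indexExp d) (invSum (indexExp d)) 0 (α.take i) m := by
    ext e
    rw [coeff_coeffwise, coeff_regularSeries]
  rw [h1, h2, coeffwise_mul_map, mul_comm (PowerSeries.map _ _), coeffwise_mul_map, h3,
    mul_comm (X ^ _)]

/-- The regular factor of the regularized sum. -/
noncomputable def regularFactor (d : ℚ) (v : List ℕ) :
    PowerSeries (Polynomial (MvPowerSeries ℕ+ ℚ)) :=
  expShift Polynomial.X d ^ v.length * PowerSeries.map Polynomial.C (regularSeries d v)

/-- Used with `x = z`, `y = z⁻¹` and `U = e^{tδz}`: the pole and the `t`-dependence of the whole sum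
come out as factors depending only on the length. -/
lemma conv_scale {S T : Type*} [CommRing S] [CommRing T] (ψ : S →+* T) {y U : T} {x : S}
    (hx : y * ψ x = 1) (Q : List ℕ → S) (g : ℕ → S) (α : List ℕ) :
    conv (fun v => U ^ v.length * ψ (Q v)) (onZeros fun r => (y * U) ^ r * ψ (g r)) α =
      y ^ α.length * (U ^ α.length * ψ (conv (fun v => x ^ v.length * Q v) (onZeros g) α)) := by
  rw [map_conv, ← mul_assoc, ← mul_pow, ← conv_pow_length]
  refine conv_congr (fun v => ?_) (fun v => ?_) α
  · rw [map_mul, map_pow, ← mul_assoc, ← mul_pow, mul_right_comm, hx, one_mul]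
  · unfold onZeros
    split_ifs
    · rfl
    · rw [map_zero, mul_zero]

lemma conv_regularFactor (d : ℚ) (α : List ℕ) :
    conv (fun v => HahnSeries.ofPowerSeries ℤ _ (regularFactor d v))
      (onZeros (zerosLaurent Polynomial.X d)) α =
    zInv (Polynomial (MvPowerSeries ℕ+ ℚ)) ^ α.length * HahnSeries.ofPowerSeries ℤ _
      (expShift Polynomial.X d ^ α.length * PowerSeries.map Polynomial.C (totalSeries d α)) := by
  let ψ : PowerSeries (MvPowerSeries ℕ+ ℚ) →+* Target :=
    (HahnSeries.ofPowerSeries ℤ _).comp (PowerSeries.map Polynomial.C)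
  have hx : zInv (Polynomial (MvPowerSeries ℕ+ ℚ)) * ψ X = 1 := by
    change zInv _ * HahnSeries.ofPowerSeries ℤ _ (PowerSeries.map Polynomial.C X) = 1
    rw [map_X, zInv_mul_X]
  have h := conv_scale (T := Target) ψ
    (U := HahnSeries.ofPowerSeries ℤ (Polynomial (MvPowerSeries ℕ+ ℚ))
      (expShift Polynomial.X d)) hx
    (regularSeries d) (fun r => PowerSeries.map (algebraMap ℚ _) (zerosSeries d r)) α
  have h1 : ∀ v, HahnSeries.ofPowerSeries ℤ _ (regularFactor d v) =
      HahnSeries.ofPowerSeries ℤ _ (expShift Polynomial.X d) ^ v.length *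
        ψ (regularSeries d v) := fun v => by
    rw [regularFactor, map_mul, map_pow]
    rfl
  have h3 : zerosLaurent Polynomial.X d = fun r => (zInv (Polynomial (MvPowerSeries ℕ+ ℚ)) *
      HahnSeries.ofPowerSeries ℤ _ (expShift Polynomial.X d)) ^ r *
        ψ (PowerSeries.map (algebraMap ℚ _) (zerosSeries d r)) := funext fun r => by
    have h4 : PowerSeries.map (algebraMap ℚ (Polynomial (MvPowerSeries ℕ+ ℚ)))
        (zerosSeries d r) = PowerSeries.map Polynomial.C
          (PowerSeries.map (algebraMap ℚ (MvPowerSeries ℕ+ ℚ)) (zerosSeries d r)) := by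
      ext e : 1
      simp only [coeff_map]
      rfl
    rw [zerosLaurent, ratToLaurent_apply, h4]
    rfl
  rw [map_mul, map_pow, h3]
  exact (conv_congr h1 (fun _ => rfl) α).trans h

lemma coeff_zInv_pow_mul {A : Type*} [CommRing A] (n : ℕ) (p : PowerSeries A) (e : ℤ) :
    (zInv A ^ n * HahnSeries.ofPowerSeries ℤ A p).coeff e =
      (HahnSeries.ofPowerSeries ℤ A p).coeff (e + n) := by
  rw [zInv, HahnSeries.single_pow, HahnSeries.coeff_single_mul]
  simp

/-- The regularized sum in a constant direction. -/
theorem isRegularization_conv (δ : ℕ+) (α : List ℕ) :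
    IsRegularization (constWord δ α)
      (conv (fun v => HahnSeries.ofPowerSeries ℤ _ (regularFactor (δ : ℕ) v))
        (onZeros (zerosLaurent Polynomial.X (δ : ℕ))) α) := by
  rw [isRegularization_iff, conv_regularFactor]
  intro m t _
  filter_upwards [eventually_hasEval_coeffSeries δ m α, self_mem_nhdsWithin] with z hz hre
  have hz0 : z ≠ 0 := fun h => by simp [h] at hre
  rw [regularizedCoeff_constWord δ α m t hre, hasSum_int_iff (N := α.length) (fun n hn => by
    rw [coeff_zInv_pow_mul, PowerSeries.coeff_coe, if_pos (by omega), map_zero]) hz0]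
  have h := (hasEval_exp z (t * (δ : ℕ))).pow α.length |>.mul hz
  have hval : z ^ α.length * (Complex.exp (t * (δ : ℕ) * z) ^ α.length *
      iterCoeff (fun i => Complex.exp ((δ : ℕ) * z) ^ (i + 1))
        (fun n r => Complex.exp ((δ : ℕ) * z) ^ (n * r) *
          zerosValue (Complex.exp ((δ : ℕ) * z)) r) 0 α m) =
      Complex.exp (t * (δ : ℕ) * z) ^ α.length * (z ^ α.length *
      iterCoeff (fun i => Complex.exp ((δ : ℕ) * z) ^ (i + 1))
        (fun n r => Complex.exp ((δ : ℕ) * z) ^ (n * r) *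
          zerosValue (Complex.exp ((δ : ℕ) * z)) r) 0 α m) := by ring
  rw [hval]
  convert h using 1
  ext j
  rw [coeff_mk, coeff_zInv_pow_mul, sub_add_cancel, PowerSeries.coeff_coe,
    if_neg (by omega), Int.natAbs_natCast, coeff_mul, coeff_mul, map_sum]
  refine Finset.sum_congr rfl fun c _ => ?_
  rw [coeff_map, coeff_map, ← coeffwise_totalSeries, coeff_coeffwise, coeff_expShift_pow,
    ← map_pow, exp_pow_eq_rescale_exp, rescale_rescale, coeff_rescale, coeff_exp]
  -- The variable `t` enters only through `e^{|α|tδz}`, so each product of coefficients is a single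
  -- monomial in `t`, on which `evalAt` is explicit.
  have h4 : ((α.length : Polynomial (MvPowerSeries ℕ+ ℚ)) *
      (((δ : ℕ) : ℚ) • Polynomial.X)) ^ c.1 * algebraMap ℚ _ (1 / c.1.factorial : ℚ) *
      Polynomial.C (coeff c.2 (totalSeries (δ : ℕ) α)) =
      Polynomial.monomial c.1 (MvPowerSeries.C
        ((α.length * (δ : ℕ) : ℚ) ^ c.1 * (1 / c.1.factorial)) *
        coeff c.2 (totalSeries (δ : ℕ) α)) := by
    rw [← Polynomial.C_mul_X_pow_eq_monomial, Algebra.smul_def,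
      ← map_natCast (algebraMap ℚ (Polynomial (MvPowerSeries ℕ+ ℚ))), ← mul_assoc, ← map_mul,
      mul_pow, ← map_pow]
    simp only [Polynomial.algebraMap_apply, MvPowerSeries.algebraMap_apply, map_mul, map_pow]
    simp
  rw [h4, evalAt_monomial, MvPowerSeries.coeff_C_mul]
  simp
  ring

/-- At `z = 0` every exponential becomes `1`, including the one carrying `t`; the regular factor
thus contributes only constants in `t`. -/
lemma constantCoeff_regularFactor (d : ℚ) (v : List ℕ) :
    constantCoeff (regularFactor d v) = Polynomial.C (regularValue ℚ 0 v) := by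
  have h1 : ∀ i, constantCoeff (indexExp d i) = 1 := fun i => by
    rw [← coeff_zero_eq_constantCoeff_apply, indexExp, coeff_rescale]
    simp
  rw [regularFactor, map_mul, ← coeff_zero_eq_constantCoeff_apply,
    ← coeff_zero_eq_constantCoeff_apply, coeff_expShift_pow, coeff_map]
  have h2 : coeff 0 (regularSeries d v) = regularValue ℚ 0 v := by
    ext m
    rw [coeff_regularValue, coeff_regularSeries, coeff_zero_eq_constantCoeff_apply, map_iterCoeff]
    simp [map_invSum, h1]
  rw [h2]
  simp

lemma regularFactor_nil (d : ℚ) : regularFactor d [] = 1 := by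
  have h : regularSeries d [] = 1 := by
    classical
    ext e m
    rw [coeff_regularSeries, iterCoeff, coeff_one]
    by_cases he : e = 0 <;> by_cases hm : m = 0 <;>
      simp [he, hm, coeff_one, MvPowerSeries.coeff_one]
  simp [regularFactor, h]

/-- The values of the renormalization on the words in a constant direction. -/
theorem directional_constWord (δ : ℕ+) (α : List ℕ) :
    directional (constWord δ α) = conv (fun v => Polynomial.C (regularValue ℚ 0 v))
      (onZeros (expInt fun j => (-1) ^ j * (-Polynomial.X - algebraMap ℚ _ (1 / 2)))) α := by
  have hδ : (0 : ℚ) < (δ : ℕ) := by exact_mod_cast δ.pos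
  have h := (birkhoff_eq_conv (δ := δ) (Q := regularFactor (δ : ℕ)) (regularFactor_nil _)
    (x := zerosLaurent Polynomial.X (δ : ℕ)) (m := zerosMinus _ (δ : ℕ))
    (p := zerosPlus Polynomial.X (δ : ℕ)) (by simp [zerosLaurent, zerosSeries_zero])
    (by rw [zerosMinus, expInt_zero]) (fun r n hn => coeff_zerosMinus _ r hn)
    (sum_zerosLaurent_mul_zerosMinus _ hδ)
    (fun α => regularization_eq (isRegularization_conv δ α)) α).2
  rw [directional, h, PowerSeries.coeff_coe, if_neg (by omega), Int.natAbs_zero,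
    coeff_zero_eq_constantCoeff_apply, map_conv]
  refine conv_congr (constantCoeff_regularFactor _) (fun v => ?_) α
  unfold onZeros
  split_ifs
  · rw [constantCoeff_zerosPlus _ hδ]
  · rw [map_zero]

end Existence

/-! ### Renormalized functions as polynomials in `t`. -/

section RenormalizedAlgebra

variable {k : Type*} [CommRing k] [Algebra ℚ k]

variable (k) in
/-- The renormalized monomial quasisymmetric functions of the words `0^r`, for `r ≥ 1`. -/
noncomputable def zerosRen : ℕ → Polynomial (MvPowerSeries ℕ+ k) :=
  expInt fun j => (-1) ^ j * (-Polynomial.X - algebraMap k _ (algebraMap ℚ k (1 / 2)))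

lemma zerosRen_zero : zerosRen k 0 = 1 := expInt_zero _

/-- With `c = -t - 1/2`, this is the recurrence `(r+1) binom(c, r+1) = (c - r) binom(c, r)` solved
for `t binom(c, r)`. -/
lemma X_mul_zerosRen (r : ℕ) : Polynomial.X * zerosRen k r =
    (-(r + 1) : k) • zerosRen k (r + 1) - (algebraMap ℚ k (1 / 2) + r) • zerosRen k r := by
  have h := expInt_alternating (-Polynomial.X - algebraMap k (Polynomial (MvPowerSeries ℕ+ k))
    (algebraMap ℚ k (1 / 2))) r
  rw [← zerosRen] at h
  simp only [Algebra.smul_def, map_neg, map_add, map_natCast, map_one]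
  linear_combination h

lemma renMonomial_eq_conv (δ : ℕ+) (α : List ℕ) :
    renMonomial k δ α = conv (fun v => Polynomial.C (regularValue k 0 v))
      (onZeros (zerosRen k)) α := by
  have h := congrArg (Polynomial.mapRingHom (MvPowerSeries.map (algebraMap ℚ k)))
    (directional_constWord δ α)
  rw [map_conv] at h
  refine h.trans (conv_congr (fun v => ?_) (fun v => ?_) α)
  · rw [Polynomial.coe_mapRingHom, Polynomial.map_C, map_regularValue]
  · have h2 : (Polynomial.mapRingHom (MvPowerSeries.map (algebraMap ℚ k)))
        (algebraMap ℚ (Polynomial (MvPowerSeries ℕ+ ℚ)) (1 / 2)) =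
        algebraMap k (Polynomial (MvPowerSeries ℕ+ k)) (algebraMap ℚ k (1 / 2)) :=
      RingHom.congr_fun (Subsingleton.elim
        ((Polynomial.mapRingHom (MvPowerSeries.map (σ := ℕ+) (algebraMap ℚ k))).comp
          (algebraMap ℚ (Polynomial (MvPowerSeries ℕ+ ℚ))))
        ((algebraMap k (Polynomial (MvPowerSeries ℕ+ k))).comp (algebraMap ℚ k))) _
    unfold onZeros
    split_ifs
    · rw [map_expInt, zerosRen]
      simp only [map_mul, map_pow, map_neg, map_one, map_sub, h2]
      rw [Polynomial.coe_mapRingHom, Polynomial.map_X]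
    · rw [map_zero]

lemma renMonomial_append_replicate (δ : ℕ+) {u : List ℕ} (hu : IsLeftWeak u) (r : ℕ) :
    renMonomial k δ (u ++ List.replicate r 0) =
      ∑ p ∈ Finset.HasAntidiagonal.antidiagonal r,
        Polynomial.C (regularValue k 0 (u ++ List.replicate p.1 0)) * zerosRen k p.2 := by
  rw [renMonomial_eq_conv, conv_onZeros_append_replicate _ _ hu]

/-- In the expansion of the renormalized `M_{u0^r}`, the term with no zeros kept after `u` is `M_u`
times `zerosRen k r`; the other terms have a smaller second index and coefficients in `LWQSym k`. -/
lemma C_mul_zerosRen_mem (δ : ℕ+) (r : ℕ) {l : MvPowerSeries ℕ+ k} (hl : l ∈ LWQSym k) :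
    Polynomial.C l * zerosRen k r ∈ RenQSym k δ := by
  induction r using Nat.strong_induction_on generalizing l with
  | _ r ih =>
    rw [LWQSym] at hl
    induction hl using Submodule.span_induction with
    | mem f hf =>
      obtain ⟨u, hu, rfl⟩ := hf
      have h := renMonomial_append_replicate (k := k) δ hu r
      rw [← Finset.add_sum_erase _ _ (show ((0 : ℕ), r) ∈ Finset.HasAntidiagonal.antidiagonal r
        from Finset.HasAntidiagonal.mem_antidiagonal.mpr (zero_add r)), List.replicate_zero,
        List.append_nil, regularValue_eq_leftWeakMonomial hu] at h
      rw [← sub_eq_iff_eq_add] at h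
      rw [← h]
      refine sub_mem (Submodule.subset_span ⟨_, rfl⟩) (sum_mem fun p hp => ?_)
      rw [Finset.mem_erase, Finset.HasAntidiagonal.mem_antidiagonal] at hp
      refine ih p.2 ?_ (regularValue_mem _)
      have : p.1 ≠ 0 := fun h0 => hp.1 (Prod.ext h0 (by simpa [h0] using hp.2))
      omega
    | zero => simp
    | add f g _ _ hf hg =>
      rw [map_add, add_mul]
      exact add_mem hf hg
    | smul a f _ hf =>
      rw [← Polynomial.smul_C, smul_mul_assoc]
      exact Submodule.smul_mem _ a hf

lemma C_mul_X_pow_mul_zerosRen_mem (δ : ℕ+) (n r : ℕ) {l : MvPowerSeries ℕ+ k}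
    (hl : l ∈ LWQSym k) :
    Polynomial.C l * (Polynomial.X ^ n * zerosRen k r) ∈ RenQSym k δ := by
  induction n generalizing r with
  | zero =>
    rw [pow_zero, one_mul]
    exact C_mul_zerosRen_mem δ r hl
  | succ n ih =>
    rw [pow_succ, mul_assoc, X_mul_zerosRen, mul_sub, mul_sub, mul_smul_comm, mul_smul_comm,
      mul_smul_comm, mul_smul_comm]
    exact sub_mem (Submodule.smul_mem _ _ (ih _)) (Submodule.smul_mem _ _ (ih _))

variable (k) in
/-- The algebra of polynomials in `t` with left weak quasisymmetric coefficients. -/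
noncomputable def leftWeakPolynomials : Subalgebra k (Polynomial (MvPowerSeries ℕ+ k)) :=
  (Polynomial.mapAlgHom (leftWeakSubalgebra k).val).range

omit [Algebra ℚ k] in
lemma C_mem_leftWeakPolynomials {l : MvPowerSeries ℕ+ k} (hl : l ∈ LWQSym k) :
    Polynomial.C l ∈ leftWeakPolynomials k :=
  ⟨Polynomial.C ⟨l, hl⟩, by simp⟩

omit [Algebra ℚ k] in
lemma X_mem_leftWeakPolynomials : Polynomial.X ∈ leftWeakPolynomials k :=
  ⟨Polynomial.X, by simp⟩

/-- The recurrence `X_mul_zerosRen` is solved for its leading term, which requires dividing by `r +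
1` in `k`. -/
lemma zerosRen_mem (r : ℕ) : zerosRen k r ∈ leftWeakPolynomials k := by
  induction r with
  | zero => rw [zerosRen_zero]; exact one_mem _
  | succ r ih =>
    have h1 : ((r : k) + 1) * algebraMap ℚ k (1 / (r + 1)) = 1 := by
      have h2 : ((r : k) + 1) = algebraMap ℚ k (r + 1) := by simp
      rw [h2, ← map_mul, mul_one_div_cancel (by positivity), map_one]
    have h3 : zerosRen k (r + 1) = algebraMap ℚ k (1 / (r + 1)) •
        (-(Polynomial.X * zerosRen k r + (algebraMap ℚ k (1 / 2) + r) • zerosRen k r)) := by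
      rw [X_mul_zerosRen, sub_add_cancel, neg_smul, neg_neg, smul_smul, mul_comm, h1, one_smul]
    rw [h3]
    exact Subalgebra.smul_mem _ (neg_mem (add_mem (mul_mem X_mem_leftWeakPolynomials ih)
      (Subalgebra.smul_mem _ ih _))) _

/-- `RenQSym = LWQSym[t]`. -/
theorem toSubmodule_leftWeakPolynomials (δ : ℕ+) :
    Subalgebra.toSubmodule (leftWeakPolynomials k) = RenQSym k δ := by
  refine le_antisymm ?_ (Submodule.span_le.mpr ?_)
  · rintro _ ⟨p, rfl⟩
    induction p using Polynomial.induction_on' with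
    | add p q hp hq =>
      rw [map_add]
      exact add_mem hp hq
    | monomial n l =>
      -- Taking `r = 0`, where `zerosRen k 0 = 1`, leaves the bare monomial in `t`.
      have h := C_mul_X_pow_mul_zerosRen_mem δ n 0 (k := k) l.2
      rw [zerosRen_zero, mul_one, Polynomial.C_mul_X_pow_eq_monomial] at h
      simpa using h
  · rintro _ ⟨α, rfl⟩
    rw [renMonomial_eq_conv, conv_eq_sum_range]
    refine Subalgebra.sum_mem (leftWeakPolynomials k) fun i _ =>
      Subalgebra.mul_mem _ (C_mem_leftWeakPolynomials (regularValue_mem _)) ?_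
    unfold onZeros
    split_ifs
    · exact zerosRen_mem _
    · exact zero_mem _

lemma renMonomial_zero (δ : ℕ+) : renMonomial k δ [0] =
    -Polynomial.X - Polynomial.C (MvPowerSeries.C (algebraMap ℚ k (1 / 2))) := by
  have h := renMonomial_append_replicate (k := k) δ IsLeftWeak.nil 1
  have h1 := expInt_alternating (-Polynomial.X - algebraMap k (Polynomial (MvPowerSeries ℕ+ k))
    (algebraMap ℚ k (1 / 2))) 0
  rw [← zerosRen, Nat.cast_zero, zero_add, zero_add, one_mul, sub_zero, zerosRen_zero,
    mul_one] at h1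
  rw [Finset.Nat.antidiagonal_succ, Finset.sum_cons, Finset.Nat.antidiagonal_zero,
    Finset.map_singleton, Finset.sum_singleton] at h
  simp only [Function.Embedding.prodMap, Function.Embedding.coeFn_mk, Prod.map, List.nil_append,
    Function.Embedding.refl_apply] at h
  rw [regularValue_replicate (Nat.succ_ne_zero 0), List.replicate_zero, regularValue_nil, map_one,
    one_mul, map_zero, zero_mul, add_zero, zero_add, h1] at h
  exact h

end RenormalizedAlgebra

end RenormalizedQSym

theorem mainTheorem5 (k : Type*) [CommRing k] [Algebra ℚ k] (δ : ℕ+) :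
    (∃ (L : Subalgebra k (MvPowerSeries ℕ+ k))
        (R : Subalgebra k (Polynomial (MvPowerSeries ℕ+ k))),
      Subalgebra.toSubmodule L = RenormalizedQSym.LWQSym k ∧
      Subalgebra.toSubmodule R = RenormalizedQSym.RenQSym k δ ∧
      R = (Polynomial.mapAlgHom L.val).range) ∧
    RenormalizedQSym.renMonomial k δ [0] =
      -Polynomial.X - Polynomial.C (MvPowerSeries.C (algebraMap ℚ k (1 / 2))) :=
  ⟨⟨RenormalizedQSym.leftWeakSubalgebra k, RenormalizedQSym.leftWeakPolynomials k, rfl,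
    RenormalizedQSym.toSubmodule_leftWeakPolynomials δ, rfl⟩, RenormalizedQSym.renMonomial_zero δ⟩
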